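/- Fix real numbers $\alpha>-1$ and $\theta>0$. For real $x$ write $x^{\langle\theta\rangle}=\operatorname{sign}(x)\,|x|^{\theta}$. For $N\ge 0$ let $$w_N(x_1,\dots,x_N)=\prod_{i=1}^N|x_i|^{\alpha}e^{-x_i^2}\prod_{1\le i<j\le N}(x_i-x_j)\bigl(x_i^{\langle\theta\rangle}-x_j^{\langle\theta\rangle}\bigr),\qquad p_N=\frac{w_N}{\int_{\mathbb R^N}w_N},$$ the joint probability density of the $N$-point biorthogonal Hermite ensemble on $\mathbb R$, and for $0\le n\le N$ let $$\rho_{n,N}(x_1,\dots,x_n)=\frac{N!}{(N-n)!}\int_{\mathbb R^{N-n}}p_N(x_1,\dots,x_N)\,dx_{n+1}\cdots dx_N$$ be its $n$-point correlation function. For $\beta>-1$ and real $x,y$ put $$\mathcal K^{(\beta,\theta)}(x,y)=\sum_{k,l=0}^{\infty}\frac{(-1)^kx^k}{k!\,\Gamma\!\left(\frac{\beta+1+k}{\theta}\right)}\cdot\frac{(-1)^l(y^{\langle\theta\rangle})^{l}}{l!\,\Gamma(\beta+1+\theta l)}\cdot\frac{\theta}{\beta+1+k+\theta l},$$ $$\mathcal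 K^{\mathrm{Her}(\alpha,\theta)}(x,y)=\mathcal K^{\left(\frac{\alpha-1}2,\theta\right)}(x^2,y^2)+x\,y^{\langle\theta\rangle}\,\mathcal K^{\left(\frac{\alpha+\theta}2,\theta\right)}(x^2,y^2).$$ **Theorem 5.4.** These objects are well defined: $w_N$ is integrable with $\int w_N>0$, the integrals defining $\rho_{n,N}$ converge absolutely, and so do the double series $\mathcal K^{(\beta,\theta)}(x,y)$ for all $\beta>-1$ and $x,y\in\mathbb R$. For every $n\ge1$ and all $x_1,\dots,x_n\in\mathbb R$ (nonzero if $\alpha<0$), with $M=N/2$, $$\lim_{N\to\infty}\frac1{M^{n/(2\theta)}}\,\rho_{n,N}\!\left(\frac{x_1}{M^{1/(2\theta)}},\dots,\frac{x_n}{M^{1/(2\theta)}}\right)=\prod_{i=1}^n|x_i|^{\alpha}\cdot\det\bigl[\mathcal K^{\mathrm{Her}(\alpha,\theta)}(x_i,x_j)\bigr]_{i,j=1}^n .$$ -/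

import Mathlib

open MeasureTheory Filter Topology

noncomputable section

/-- The signed power `x ^ θ := sign x * |x| ^ θ` on the whole real line. -/
def spow (θ x : ℝ) : ℝ := Real.sign x * |x| ^ θ

/-- The unnormalized joint density of the biorthogonal Hermite ensemble of `N` points of `ℝ`,
`∏ |x_i|^α e^{-x_i²} * ∏_{i<j} (x_i - x_j) (x_i^θ - x_j^θ)`. -/
def hermiteWeight (α θ : ℝ) {N : ℕ} (x : Fin N → ℝ) : ℝ :=
  (∏ i, |x i| ^ α * Real.exp (-(x i) ^ 2)) *
    ∏ i, ∏ j ∈ Finset.Ioi i, (x i - x j) * (spow θ (x i) - spow θ (x j))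

/-- The total mass of the unnormalized density. -/
def hermitePartition (α θ : ℝ) (N : ℕ) : ℝ :=
  ∫ x : Fin N → ℝ, hermiteWeight α θ x

/-- The joint probability density of the `N`-point biorthogonal Hermite ensemble. -/
def hermiteDensity (α θ : ℝ) {N : ℕ} (x : Fin N → ℝ) : ℝ :=
  (hermitePartition α θ N)⁻¹ * hermiteWeight α θ x

/-- The `n`-point correlation function of the `N`-point ensemble, for `n ≤ N`:
`N! / (N - n)!` times the integral of the joint density over the last `N - n` variables.
For `n ≤ N` the concatenation of `x` and `y` is a vector of length `n + (N - n) = N`; for `N < n`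
(a case without meaning) the factor `N.descFactorial n` is zero. -/
def hermiteCorrelation (α θ : ℝ) (n N : ℕ) (x : Fin n → ℝ) : ℝ :=
  (N.descFactorial n : ℝ) * ∫ y : Fin (N - n) → ℝ, hermiteDensity α θ (Fin.append x y)

/-- The `(k, l)` term of the double series that defines the limit kernel. -/
def limitKernelTerm (β θ x y : ℝ) (k l : ℕ) : ℝ :=
  ((-1) ^ k * x ^ k / ((k.factorial : ℝ) * Real.Gamma ((β + 1 + k) / θ))) *
    ((-1) ^ l * spow θ y ^ l / ((l.factorial : ℝ) * Real.Gamma (β + 1 + θ * l))) *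
      (θ / (β + 1 + k + θ * l))

/-- The limit kernel `𝒦^{(β,θ)}(x, y)` of the Jacobi and Laguerre cases. -/
def limitKernel (β θ x y : ℝ) : ℝ :=
  ∑' p : ℕ × ℕ, limitKernelTerm β θ x y p.1 p.2

/-- The limit kernel `𝒦^{Her(α,θ)}(x, y)` of the Hermite case. -/
def limitKernelHer (α θ x y : ℝ) : ℝ :=
  limitKernel ((α - 1) / 2) θ (x ^ 2) (y ^ 2) +
    x * spow θ y * limitKernel ((α + θ) / 2) θ (x ^ 2) (y ^ 2)

end

/-! The density is a product of two Vandermonde determinants, in the powers `x ^ j` and in the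
powers `spow θ x ^ k`. Inserting the inverse of their Gram matrix between the two turns the density
into a constant times a determinant of a finite-rank kernel that reproduces itself under integration
(`hermiteWeight_eq_det`). Dyson's integration step (`integral_det_snoc`) then makes every
correlation function a determinant of the same kernel, and also gives the partition function.

The weight is even, so Gram entries of mixed parity vanish. The even and the odd block are
Laguerre-type matrices Γ(a + β + 1 + θ b) with β = (α - 1)/2 and β = (α + θ)/2, which is the source
of the two summands of the limit kernel.

Such a matrix is inverted explicitly: Γ(s + a) is Γ(s) times the rising factorial of s, so a row of
the inverse amounts to a Lagrange basis polynomial at the nodes β + 1 + θ b, expanded in rising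
factorials. Its values at the points -k are closed products. After resummation
(`laguerreKernel_eq_sum`) the finite kernel is the series of the limit kernel, truncated, with each
term multiplied by a factor that tends to 1 under scaling; dominated convergence for series finishes
the proof (`tendsto_laguerreKernel`). -/

noncomputable section

/-- The coefficients of a polynomial in the basis of rising factorials. -/
def newtonCoeff (P : Polynomial ℝ) (a : ℕ) : ℝ :=
  ∑ k ∈ Finset.range (a + 1),
    (-1) ^ k * P.eval (-(k : ℝ)) / ((k.factorial : ℝ) * ((a - k).factorial : ℝ))

/-- The nodes `β + 1 + θ b`. -/
def laguerreNode (β θ : ℝ) (b : ℕ) : ℝ := β + 1 + θ * b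

/-- The polynomial whose expansion in rising factorials gives the `b`-th dual function of the
biorthogonal Laguerre ensemble. -/
def laguerrePoly (β θ : ℝ) (m b : ℕ) : Polynomial ℝ :=
  Polynomial.C (Real.Gamma (laguerreNode β θ b))⁻¹ *
    Lagrange.basis (Finset.range m) (laguerreNode β θ) b

/-- The entries of the inverse of the Gram matrix `Γ(a + β + 1 + θ b)`, `a, b < m`. -/
def laguerreCoeff (β θ : ℝ) (m a b : ℕ) : ℝ := newtonCoeff (laguerrePoly β θ m b) a

/-- The Christoffel–Darboux kernel, without weight, of the biorthogonal Laguerre ensemble. -/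
def laguerreKernel (β θ : ℝ) (m : ℕ) (x y : ℝ) : ℝ :=
  ∑ a ∈ Finset.range m, ∑ b ∈ Finset.range m, x ^ a * laguerreCoeff β θ m a b * spow θ y ^ b

end

/-! ### Newton expansion in rising factorials and the inverse Laguerre Gram matrix. -/

theorem newtonCoeff_eq_fwdDiff (P : Polynomial ℝ) (a : ℕ) :
    newtonCoeff P a = (-1) ^ a / (a.factorial : ℝ) *
      (fwdDiff (-1 : ℝ))^[a] (fun t => P.eval t) 0 := by
  rw [fwdDiff_iter_eq_sum_shift, Finset.mul_sum, newtonCoeff]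
  refine Finset.sum_congr rfl fun k hk => ?_
  have hk' : k ≤ a := Nat.lt_succ_iff.mp (Finset.mem_range.mp hk)
  obtain ⟨j, rfl⟩ := Nat.exists_eq_add_of_le hk'
  have h1 : ((k + j).choose k : ℝ) * (k.factorial * j.factorial) = (k + j).factorial := by
    have := Nat.add_choose_mul_factorial_mul_factorial k j
    rw [← Nat.choose_symm_add] at this
    rw [← mul_assoc]
    exact_mod_cast this
  have h2 : ((k + j).factorial : ℝ) ≠ 0 := by positivity
  have h3 : (k.factorial : ℝ) ≠ 0 := by positivity
  have h4 : (j.factorial : ℝ) ≠ 0 := by positivity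
  have h5 : ((-1 : ℝ) ^ j) * (-1) ^ j = 1 := by rw [← mul_pow]; simp
  simp only [Nat.add_sub_cancel_left, zsmul_eq_mul, nsmul_eq_mul, zero_add]
  push_cast
  rw [mul_neg_one]
  field_simp
  rw [← h1, pow_add]
  linear_combination (-(-1) ^ k * Polynomial.eval (-(k : ℝ)) P * (k.factorial * j.factorial) *
    ((k + j).choose k)) * h5

theorem eval_ascPochhammer_neg_natCast (l a : ℕ) :
    (ascPochhammer ℝ a).eval (-(l : ℝ)) = (-1) ^ a * (a.factorial * l.choose a : ℝ) := by
  rw [ascPochhammer_eval_neg_eq_descPochhammer, descPochhammer_eval_eq_descFactorial,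
    Nat.descFactorial_eq_factorial_mul_choose]
  push_cast
  rfl

/-- Both sides have degree below m and agree at the m points 0, -1, ..., -(m - 1), where the
identity is Newton's difference formula with step -1. -/
theorem eval_eq_sum_newtonCoeff (P : Polynomial ℝ) (m : ℕ) (hP : P.degree < m) (s : ℝ) :
    P.eval s = ∑ a ∈ Finset.range m, newtonCoeff P a * (ascPochhammer ℝ a).eval s := by
  have key : P = ∑ a ∈ Finset.range m, Polynomial.C (newtonCoeff P a) * ascPochhammer ℝ a := by
    refine Polynomial.eq_of_degrees_lt_of_eval_index_eq (Finset.range m)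
      (v := fun l : ℕ => -(l : ℝ)) ?_ (by simpa using hP) ?_ ?_
    · intro a _ b _ h
      simpa using h
    · rw [Finset.card_range, ← Polynomial.mem_degreeLT]
      refine Submodule.sum_mem _ fun a ha => ?_
      rw [← Polynomial.smul_eq_C_mul]
      refine Submodule.smul_mem _ _ (Polynomial.mem_degreeLT.mpr ?_)
      refine lt_of_le_of_lt Polynomial.degree_le_natDegree ?_
      rw [ascPochhammer_natDegree]
      exact_mod_cast Finset.mem_range.mp ha
    · intro l hl
      have hl' : l + 1 ≤ m := Finset.mem_range.mp hl
      have h := shift_eq_sum_fwdDiff_iter (-1 : ℝ) (fun t => P.eval t) l 0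
      simp only [zero_add, nsmul_eq_mul, mul_neg_one] at h
      rw [h, Polynomial.eval_finsetSum, ← Finset.sum_subset (Finset.range_mono hl')]
      · refine Finset.sum_congr rfl fun a _ => ?_
        rw [Polynomial.eval_mul, Polynomial.eval_C, eval_ascPochhammer_neg_natCast,
          newtonCoeff_eq_fwdDiff]
        have h4 : (a.factorial : ℝ) ≠ 0 := by positivity
        have h5 : ((-1 : ℝ) ^ a) * (-1) ^ a = 1 := by rw [← mul_pow]; simp
        field_simp
        linear_combination (-(l.choose a : ℝ) * (fwdDiff (-1 : ℝ))^[a] (fun t => P.eval t) 0) * h5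
      · intro a _ ha
        rw [Polynomial.eval_mul, eval_ascPochhammer_neg_natCast, Nat.choose_eq_zero_of_lt]
        · simp
        · simpa using ha
  conv_lhs => rw [key]
  simp [Polynomial.eval_finsetSum]

theorem Gamma_mul_eval_ascPochhammer {s : ℝ} (hs : 0 < s) (a : ℕ) :
    Real.Gamma s * (ascPochhammer ℝ a).eval s = Real.Gamma (s + a) := by
  induction a with
  | zero => simp
  | succ a ih =>
    rw [ascPochhammer_succ_eval, ← mul_assoc, ih, Nat.cast_succ, ← add_assoc,
      Real.Gamma_add_one (by positivity), mul_comm]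

theorem laguerreNode_pos {β θ : ℝ} (hβ : -1 < β) (hθ : 0 < θ) (b : ℕ) :
    0 < laguerreNode β θ b := by
  unfold laguerreNode
  have : 0 ≤ θ * b := by positivity
  linarith

theorem laguerreNode_injective {β θ : ℝ} (hθ : 0 < θ) : Function.Injective (laguerreNode β θ) := by
  intro a b h
  simpa [laguerreNode, hθ.ne'] using h

/-- By Γ(s + a) = Γ(s) (s)_a the sum is Γ(s) P(s) at the node s of index b', where P is the b-th
Lagrange basis polynomial divided by Γ of its own node. -/
theorem sum_laguerreCoeff_mul_Gamma {β θ : ℝ} (hβ : -1 < β) (hθ : 0 < θ) {m b b' : ℕ}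
    (hb : b < m) (hb' : b' < m) :
    ∑ a ∈ Finset.range m, laguerreCoeff β θ m a b * Real.Gamma (laguerreNode β θ b' + a) =
      if b = b' then 1 else 0 := by
  have hinj := (laguerreNode_injective (β := β) hθ).injOn
    (s := ((Finset.range m : Finset ℕ) : Set ℕ))
  have hbm := Finset.mem_range.mpr hb
  have hdeg : (laguerrePoly β θ m b).degree < m := by
    rw [laguerrePoly, Polynomial.degree_C_mul
      (inv_ne_zero (Real.Gamma_pos_of_pos (laguerreNode_pos hβ hθ b)).ne'),
      Lagrange.degree_basis hinj hbm, Finset.card_range]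
    exact_mod_cast Nat.sub_lt (by omega) one_pos
  have h := eval_eq_sum_newtonCoeff _ m hdeg (laguerreNode β θ b')
  calc _ = Real.Gamma (laguerreNode β θ b') * (laguerrePoly β θ m b).eval (laguerreNode β θ b') := by
        rw [h, Finset.mul_sum]
        refine Finset.sum_congr rfl fun a _ => ?_
        rw [← Gamma_mul_eval_ascPochhammer (laguerreNode_pos hβ hθ b'), laguerreCoeff]
        ring
    _ = _ := by
        rw [laguerrePoly, Polynomial.eval_mul, Polynomial.eval_C]
        split_ifs with hbb
        · subst hbb
          rw [Lagrange.eval_basis_self hinj hbm, mul_one, mul_inv_cancel₀]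
          exact (Real.Gamma_pos_of_pos (laguerreNode_pos hβ hθ b)).ne'
        · rw [Lagrange.eval_basis_of_ne hbb (Finset.mem_range.mpr hb')]
          simp

/-! ### Closed form of the Laguerre kernel. -/

theorem prod_range_erase (f : ℕ → ℝ) (b r : ℕ) :
    ∏ i ∈ (Finset.range (b + 1 + r)).erase b, f i =
      (∏ i ∈ Finset.range b, f i) * ∏ i ∈ Finset.range r, f (b + 1 + i) := by
  have h1 : ∏ i ∈ (Finset.range (b + 1 + r)).erase b, f i =
      ∏ i ∈ (Finset.range (b + 1 + r)).erase b, Function.update f b 1 i :=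
    Finset.prod_congr rfl fun i hi => by
      rw [Function.update_of_ne (Finset.ne_of_mem_erase hi)]
  rw [h1, Finset.prod_erase _ (by simp), Finset.prod_range_add, Finset.prod_range_succ]
  simp only [Function.update_self, mul_one]
  congr 1
  · refine Finset.prod_congr rfl fun i hi => ?_
    rw [Function.update_of_ne (Finset.mem_range.mp hi).ne]
  · refine Finset.prod_congr rfl fun i _ => ?_
    rw [Function.update_of_ne (by omega)]

theorem prod_range_erase_sub (b r : ℕ) :
    ∏ i ∈ (Finset.range (b + 1 + r)).erase b, ((i : ℝ) - b) =
      (-1) ^ b * (b.factorial * r.factorial) := by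
  rw [prod_range_erase (fun i : ℕ => (i : ℝ) - b)]
  have h1 : ∏ i ∈ Finset.range b, ((i : ℝ) - b) = (-1) ^ b * b.factorial := by
    have h : (-1 : ℝ) ^ b = ∏ _i ∈ Finset.range b, (-1 : ℝ) := by simp
    rw [← Nat.descFactorial_self b, Nat.descFactorial_eq_prod_range, Nat.cast_prod, h,
      ← Finset.prod_mul_distrib]
    refine Finset.prod_congr rfl fun i hi => ?_
    rw [Nat.cast_sub (Finset.mem_range.mp hi).le]
    ring
  have h2 : ∏ i ∈ Finset.range r, (((b + 1 + i : ℕ) : ℝ) - b) = r.factorial := by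
    rw [← Finset.prod_range_add_one_eq_factorial, Nat.cast_prod]
    refine Finset.prod_congr rfl fun i _ => ?_
    push_cast
    ring
  rw [h1, h2]
  ring

theorem prod_range_add_eq_Gamma {κ : ℝ} (hκ : 0 < κ) (m : ℕ) :
    ∏ i ∈ Finset.range m, (κ + i) = Real.Gamma (κ + m) / Real.Gamma κ := by
  rw [eq_div_iff (Real.Gamma_pos_of_pos hκ).ne']
  induction m with
  | zero => simp
  | succ a ih =>
    rw [Finset.prod_range_succ, Nat.cast_succ, ← add_assoc,
      Real.Gamma_add_one (by positivity), ← ih]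
    ring

/-- At -k each Lagrange factor is ((β + 1 + k)/θ + i)/(i - b). The numerators over all i < m give a
quotient of Gamma values; the absent factor i = b is what produces θ/(β + 1 + k + θ b), the only
part coupling k and b in the limit kernel. -/
theorem eval_laguerrePoly_neg_natCast {β θ : ℝ} (hβ : -1 < β) (hθ : 0 < θ) {m b : ℕ} (hb : b < m)
    (k : ℕ) :
    (laguerrePoly β θ m b).eval (-(k : ℝ)) =
      (-1) ^ b / (b.factorial * Real.Gamma (β + 1 + θ * b)) * (θ / (β + 1 + k + θ * b)) *
        (Real.Gamma ((β + 1 + k) / θ + m) / Real.Gamma ((β + 1 + k) / θ) /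
          ((m - 1 - b).factorial : ℝ)) := by
  obtain ⟨r, rfl⟩ := Nat.exists_eq_add_of_le (Nat.succ_le_of_lt hb)
  have hβk : 0 < β + 1 + k := by
    have : (0 : ℝ) ≤ k := by positivity
    linarith
  have hκ : 0 < (β + 1 + k) / θ := by positivity
  rw [laguerrePoly, Polynomial.eval_mul, Polynomial.eval_C, Lagrange.basis,
    Polynomial.eval_prod]
  have h1 : ∏ i ∈ (Finset.range (b + 1 + r)).erase b,
      ((Lagrange.basisDivisor (laguerreNode β θ b) (laguerreNode β θ i)).eval (-(k : ℝ))) =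
      (∏ i ∈ (Finset.range (b + 1 + r)).erase b, ((β + 1 + k) / θ + i)) /
        ∏ i ∈ (Finset.range (b + 1 + r)).erase b, ((i : ℝ) - b) := by
    rw [← Finset.prod_div_distrib]
    refine Finset.prod_congr rfl fun i hi => ?_
    have hne : (i : ℝ) - b ≠ 0 := by
      rw [sub_ne_zero]
      exact_mod_cast Finset.ne_of_mem_erase hi
    have hne' : (b : ℝ) - i ≠ 0 := by
      rw [← neg_sub]
      exact neg_ne_zero.mpr hne
    have h2 : laguerreNode β θ b - laguerreNode β θ i = θ * (b - i) := by
      unfold laguerreNode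
      ring
    rw [Lagrange.basisDivisor, Polynomial.eval_mul, Polynomial.eval_C, h2]
    simp only [Polynomial.eval_sub, Polynomial.eval_X, Polynomial.eval_C, laguerreNode]
    field_simp
    ring
  have h3 : ∏ i ∈ (Finset.range (b + 1 + r)).erase b, ((β + 1 + k) / θ + i) =
      Real.Gamma ((β + 1 + k) / θ + ((b + 1 + r : ℕ) : ℝ)) / Real.Gamma ((β + 1 + k) / θ) *
        (θ / (β + 1 + k + θ * b)) := by
    rw [← prod_range_add_eq_Gamma hκ, ← Finset.prod_erase_mul _ _ (Finset.mem_range.mpr hb)]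
    have : 0 < β + 1 + k + θ * b := by positivity
    field_simp
  have h4 : b + 1 + r - 1 - b = r := by omega
  rw [h1, h3, prod_range_erase_sub, h4, laguerreNode]
  have h5 : ((-1 : ℝ) ^ b) * (-1) ^ b = 1 := by rw [← mul_pow]; simp
  have h6 : ((-1 : ℝ) ^ b) ≠ 0 := by positivity
  have h7 : ((-1 : ℝ) ^ b)⁻¹ = (-1) ^ b := inv_eq_of_mul_eq_one_right h5
  simp only [div_eq_mul_inv, mul_inv, h7]
  ring

/-- Put a = k + j in the Newton coefficients and sum over j first: this leaves a truncated
exponential in x, and all dependence on m sits in the factor beside `limitKernelTerm`. -/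
theorem laguerreKernel_eq_sum {β θ : ℝ} (hβ : -1 < β) (hθ : 0 < θ) (m : ℕ) (x y : ℝ) :
    laguerreKernel β θ m x y = ∑ k ∈ Finset.range m, ∑ b ∈ Finset.range m,
      limitKernelTerm β θ x y k b *
        (Real.Gamma ((β + 1 + k) / θ + m) / ((m - 1 - b).factorial : ℝ) *
          ∑ j ∈ Finset.range (m - k), x ^ j / (j.factorial : ℝ)) := by
  rw [laguerreKernel, Finset.sum_comm]
  conv_rhs => rw [Finset.sum_comm]
  refine Finset.sum_congr rfl fun b hb => ?_
  have hflip := Finset.sum_range_diag_flip m (fun k j =>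
    spow θ y ^ b * ((-1) ^ k * (laguerrePoly β θ m b).eval (-(k : ℝ)) / k.factorial *
      (x ^ k * (x ^ j / (j.factorial : ℝ)))))
  trans ∑ a ∈ Finset.range m, ∑ k ∈ Finset.range (a + 1),
    spow θ y ^ b * ((-1) ^ k * (laguerrePoly β θ m b).eval (-(k : ℝ)) / k.factorial *
      (x ^ k * (x ^ (a - k) / ((a - k).factorial : ℝ))))
  · refine Finset.sum_congr rfl fun a _ => ?_
    rw [laguerreCoeff, newtonCoeff, Finset.mul_sum, Finset.sum_mul]
    refine Finset.sum_congr rfl fun k hk => ?_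
    have hk' : k ≤ a := Nat.lt_succ_iff.mp (Finset.mem_range.mp hk)
    have : x ^ a = x ^ k * x ^ (a - k) := by rw [← pow_add, Nat.add_sub_cancel' hk']
    rw [this]
    field_simp
  · rw [hflip]
    refine Finset.sum_congr rfl fun k _ => ?_
    rw [Finset.mul_sum, Finset.mul_sum]
    refine Finset.sum_congr rfl fun j _ => ?_
    rw [eval_laguerrePoly_neg_natCast hβ hθ (Finset.mem_range.mp hb), limitKernelTerm]
    simp only [div_eq_mul_inv, mul_inv]
    ring

/-! ### Gamma estimates, convergence of the double series and the Laguerre scaling limit. -/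

theorem half_le_Gamma {x : ℝ} (hx : 0 < x) : 1 / 2 ≤ Real.Gamma x := by
  have key : ∀ y : ℝ, 2 ≤ y → 1 ≤ Real.Gamma y := fun y hy => by
    rw [← Real.Gamma_two]
    exact Real.Gamma_strictMonoOn_Ici.monotoneOn (Set.mem_Ici.mpr le_rfl) hy hy
  have key' : ∀ y : ℝ, 1 ≤ y → 1 / 2 ≤ Real.Gamma y := fun y hy => by
    rcases le_total 2 y with h | h
    · linarith [key y h]
    · have h1 := key (y + 1) (by linarith)
      rw [Real.Gamma_add_one (by positivity)] at h1
      nlinarith [Real.Gamma_pos_of_pos (show 0 < y by linarith)]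
  rcases le_total 1 x with h | h
  · exact key' x h
  · have h1 := key' (x + 1) (by linarith)
    rw [Real.Gamma_add_one (by positivity)] at h1
    nlinarith [Real.Gamma_pos_of_pos hx]

theorem abs_limitKernelTerm_le {β θ : ℝ} (hβ : -1 < β) (hθ : 0 < θ) (x y : ℝ) (k l : ℕ) :
    |limitKernelTerm β θ x y k l| ≤
      4 * (θ / (β + 1)) *
        ((|x| ^ k / (k.factorial : ℝ)) * (|spow θ y| ^ l / (l.factorial : ℝ))) := by
  have hβ' : 0 < β + 1 := by linarith
  have h1 : 0 < (β + 1 + k) / θ := by positivity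
  have h2 : 0 < β + 1 + θ * l := by positivity
  have hG1 := half_le_Gamma h1
  have hG2 := half_le_Gamma h2
  have hp1 := Real.Gamma_pos_of_pos h1
  have hp2 := Real.Gamma_pos_of_pos h2
  have h3 : θ / (β + 1 + k + θ * l) ≤ θ / (β + 1) := by
    apply div_le_div_of_nonneg_left hθ.le hβ'
    have : 0 ≤ θ * l := by positivity
    have : (0 : ℝ) ≤ k := by positivity
    linarith
  have h4 : |x| ^ k / ((k.factorial : ℝ) * Real.Gamma ((β + 1 + k) / θ)) ≤
      2 * (|x| ^ k / (k.factorial : ℝ)) := by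
    rw [div_mul_eq_div_div, div_le_iff₀ hp1]
    have : 0 ≤ |x| ^ k / (k.factorial : ℝ) := by positivity
    nlinarith
  have h5 : |spow θ y| ^ l / ((l.factorial : ℝ) * Real.Gamma (β + 1 + θ * l)) ≤
      2 * (|spow θ y| ^ l / (l.factorial : ℝ)) := by
    rw [div_mul_eq_div_div, div_le_iff₀ hp2]
    have : 0 ≤ |spow θ y| ^ l / (l.factorial : ℝ) := by positivity
    nlinarith
  have h6 : 0 < β + 1 + k + θ * l := by positivity
  rw [limitKernelTerm, abs_mul, abs_mul, abs_div, abs_div, abs_mul, abs_mul, abs_mul, abs_mul,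
    abs_pow, abs_pow, abs_pow, abs_pow, abs_neg, abs_one, one_pow, one_mul, one_pow, one_mul,
    abs_of_pos hp1, abs_of_pos hp2, Nat.abs_cast, Nat.abs_cast,
    abs_of_pos (div_pos hθ h6)]
  calc _ ≤ (2 * (|x| ^ k / (k.factorial : ℝ))) * (2 * (|spow θ y| ^ l / (l.factorial : ℝ))) *
        (θ / (β + 1)) := by gcongr
    _ = _ := by ring

/-- The factorials absorb any geometric growth. The weights p and q leave room for the majorant
needed in the scaling limit. -/
theorem summable_abs_limitKernelTerm_mul_pow {β θ : ℝ} (hβ : -1 < β) (hθ : 0 < θ) (x y : ℝ)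
    {p q : ℝ} (hp : 0 ≤ p) (hq : 0 ≤ q) :
    Summable fun i : ℕ × ℕ => |limitKernelTerm β θ x y i.1 i.2| * (p ^ i.1 * q ^ i.2) := by
  have hs := ((Real.summable_pow_div_factorial (|x| * p)).mul_of_nonneg
    (Real.summable_pow_div_factorial (|spow θ y| * q)) (fun k => by positivity)
    (fun k => by positivity)).mul_left (4 * (θ / (β + 1)))
  refine Summable.of_nonneg_of_le (fun i => by positivity) (fun i => ?_) hs
  calc _ ≤ _ := mul_le_mul_of_nonneg_right (abs_limitKernelTerm_le hβ hθ x y i.1 i.2)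
        (by positivity)
    _ = _ := by
      rw [mul_pow, mul_pow]
      ring

theorem summable_limitKernelTerm {β θ : ℝ} (hβ : -1 < β) (hθ : 0 < θ) (x y : ℝ) :
    Summable fun i : ℕ × ℕ => limitKernelTerm β θ x y i.1 i.2 := by
  have h := summable_abs_limitKernelTerm_mul_pow hβ hθ x y zero_le_one zero_le_one
  simp only [one_pow, mul_one] at h
  exact h.of_abs

/-- Convexity of log Γ: its slope over [a, a + κ] is at most its slope over [a + κ, a + κ + 1],
which is log (a + κ). The bound is uniform in κ, as domination requires. -/
theorem Gamma_add_le_mul_rpow {a κ : ℝ} (ha : 0 < a) (hκ : 0 < κ) :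
    Real.Gamma (κ + a) ≤ Real.Gamma a * (a + κ) ^ κ := by
  have h := Real.convexOn_log_Gamma.slope_mono_adjacent (x := a) (y := κ + a) (z := κ + a + 1)
    ha (by simp only [Set.mem_Ioi]; positivity) (by linarith) (by linarith)
  have hp : 0 < κ + a := by positivity
  have hG := Real.Gamma_pos_of_pos hp
  have hGa := Real.Gamma_pos_of_pos ha
  simp only [Function.comp_apply, add_sub_cancel_left, add_sub_cancel_right, div_one] at h
  rw [Real.Gamma_add_one hp.ne', Real.log_mul hp.ne' hG.ne', add_sub_cancel_right,
    div_le_iff₀ hκ] at h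
  rw [← Real.log_le_log_iff hG (by positivity), Real.log_mul hGa.ne' (by positivity),
    Real.log_rpow (by positivity), add_comm a κ]
  linarith

theorem tendsto_Gamma_add_div {κ : ℝ} (hκ : 0 < κ) :
    Tendsto (fun n : ℕ => Real.Gamma (κ + n) / (Real.Gamma n * (n : ℝ) ^ κ)) atTop (𝓝 1) := by
  have hG := Real.Gamma_pos_of_pos hκ
  have h1 := (tendsto_const_nhds (x := Real.Gamma κ)).div (Real.GammaSeq_tendsto_Gamma κ) hG.ne'
  -- Euler's sequence involves Γ(κ + n + 1)/Γ(n + 1); this factor shifts both arguments down by one.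
  have h2 : Tendsto (fun n : ℕ => (n : ℝ) / (n + κ)) atTop (𝓝 1) :=
    tendsto_natCast_div_add_atTop κ
  have h3 := h1.mul h2
  rw [div_self hG.ne', one_mul] at h3
  refine h3.congr' ?_
  filter_upwards [eventually_ge_atTop 1] with n hn
  have hn' : (0 : ℝ) < n := by exact_mod_cast hn
  have hκn : 0 < κ + n := by positivity
  rw [Pi.div_apply, Real.GammaSeq, prod_range_add_eq_Gamma hκ, Nat.cast_succ, ← add_assoc,
    Real.Gamma_add_one hκn.ne', ← Real.Gamma_nat_eq_factorial, Real.Gamma_add_one hn'.ne']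
  have := Real.Gamma_pos_of_pos hn'
  have := Real.Gamma_pos_of_pos hκn
  have : 0 < (n : ℝ) ^ κ := by positivity
  rw [add_comm (n : ℝ) κ]
  field_simp

theorem Gamma_natCast_div_factorial {n b : ℕ} (hb : b < n) :
    Real.Gamma n / ((n - 1 - b).factorial : ℝ) = ((n - 1).descFactorial b : ℝ) := by
  obtain ⟨n, rfl⟩ := Nat.exists_eq_add_of_le' (Nat.one_le_of_lt hb)
  have h := Nat.factorial_mul_descFactorial (n := n) (k := b) (by omega)
  rw [Nat.cast_succ, Real.Gamma_nat_eq_factorial, ← h, Nat.add_sub_cancel]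
  push_cast
  field_simp

theorem tendsto_descFactorial_div_pow (b : ℕ) :
    Tendsto (fun n : ℕ => ((n - 1).descFactorial b : ℝ) / (n : ℝ) ^ b) atTop (𝓝 1) := by
  have h : Tendsto (fun n : ℕ => ∏ i ∈ Finset.range b, (1 - (1 + (i : ℝ)) / n)) atTop
      (𝓝 (∏ _i ∈ Finset.range b, (1 - 0))) := by
    refine tendsto_finsetProd _ fun i _ => ?_
    exact tendsto_const_nhds.sub (tendsto_const_div_atTop_nhds_zero_nat _)
  simp only [sub_zero, Finset.prod_const_one] at h
  refine h.congr' ?_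
  filter_upwards [eventually_ge_atTop (b + 1)] with n hn
  have hpow : (n : ℝ) ^ b = ∏ _i ∈ Finset.range b, (n : ℝ) := by simp
  rw [Nat.descFactorial_eq_prod_range, Nat.cast_prod, hpow, ← Finset.prod_div_distrib]
  refine Finset.prod_congr rfl fun i hi => ?_
  have hi' := Finset.mem_range.mp hi
  have hn' : (n : ℝ) ≠ 0 := by
    have : n ≠ 0 := by omega
    exact_mod_cast this
  rw [Nat.sub_sub, Nat.cast_sub (by omega)]
  push_cast
  field_simp

theorem spow_div_rpow {θ y M : ℝ} (hθ : 0 < θ) (hM : 0 < M) :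
    spow θ (y / M ^ (1 / θ)) = spow θ y / M := by
  have hp : 0 < M ^ (1 / θ) := by positivity
  have h1 : Real.sign (y / M ^ (1 / θ)) = Real.sign y := by
    rcases lt_trichotomy y 0 with h | h | h
    · rw [Real.sign_of_neg h, Real.sign_of_neg (div_neg_of_neg_of_pos h hp)]
    · simp [h]
    · rw [Real.sign_of_pos h, Real.sign_of_pos (by positivity)]
  rw [spow, spow, h1, abs_div, abs_of_pos hp, Real.div_rpow (abs_nonneg y) hp.le,
    ← Real.rpow_mul hM.le, one_div_mul_cancel hθ.ne', Real.rpow_one, mul_div_assoc]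

theorem rpow_add_natCast_div {β θ M : ℝ} (hM : 0 < M) (k : ℕ) :
    M ^ ((β + 1 + k) / θ) = M ^ ((β + 1) / θ) * (M ^ (1 / θ)) ^ k := by
  rw [← Real.rpow_natCast (M ^ (1 / θ)), ← Real.rpow_mul hM.le, ← Real.rpow_add hM]
  congr 1
  ring

theorem limitKernelTerm_scale {β θ M : ℝ} (hθ : 0 < θ) (hM : 0 < M) (x y : ℝ) (k l : ℕ) :
    (M ^ ((β + 1) / θ))⁻¹ * limitKernelTerm β θ (x / M ^ (1 / θ)) (y / M ^ (1 / θ)) k l =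
      limitKernelTerm β θ x y k l * (M ^ ((β + 1 + k) / θ) * M ^ l)⁻¹ := by
  rw [limitKernelTerm, limitKernelTerm, spow_div_rpow hθ hM, rpow_add_natCast_div hM,
    div_pow, div_pow]
  simp only [div_eq_mul_inv, mul_inv]
  ring

theorem tendsto_sum_pow_div_factorial {u : ℕ → ℝ} {r : ℕ → ℕ} (hu : Tendsto u atTop (𝓝 0))
    (hu0 : ∀ᶠ N in atTop, 0 ≤ u N) (hr : ∀ᶠ N in atTop, 0 < r N) :
    Tendsto (fun N => ∑ j ∈ Finset.range (r N), u N ^ j / (j.factorial : ℝ)) atTop (𝓝 1) := by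
  have hexp : Tendsto (fun N => Real.exp (u N)) atTop (𝓝 1) := by
    have h := (Real.continuous_exp.tendsto 0).comp hu
    rwa [Real.exp_zero] at h
  refine tendsto_of_tendsto_of_tendsto_of_le_of_le' tendsto_const_nhds hexp ?_ ?_
  · filter_upwards [hu0, hr] with N h0 h1
    calc (1 : ℝ) = u N ^ 0 / ((0 : ℕ).factorial : ℝ) := by simp
      _ ≤ _ := Finset.single_le_sum (f := fun j => u N ^ j / (j.factorial : ℝ))
        (fun j _ => by positivity) (Finset.mem_range.mpr h1)
  · filter_upwards [hu0] with N h0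
    exact Real.sum_le_exp_of_nonneg h0 _

/-- The size m and the scale M are kept separate because the even and odd Hermite blocks have sizes
⌈N/2⌉ and ⌊N/2⌋ but share M = N/2. -/
theorem tendsto_laguerreKernel {β θ : ℝ} (hβ : -1 < β) (hθ : 0 < θ) {m : ℕ → ℕ} {M : ℕ → ℝ}
    (hM : Tendsto M atTop atTop) (hmM : Tendsto (fun N => (m N : ℝ) / M N) atTop (𝓝 1))
    {x : ℝ} (hx : 0 ≤ x) (y : ℝ) :
    Tendsto (fun N => (M N ^ ((β + 1) / θ))⁻¹ *
        laguerreKernel β θ (m N) (x / M N ^ (1 / θ)) (y / M N ^ (1 / θ)))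
      atTop (𝓝 (limitKernel β θ x y)) := by
  have hβ' : 0 < β + 1 := by linarith
  have hm : Tendsto m atTop atTop := by
    rw [← tendsto_natCast_atTop_iff (R := ℝ)]
    refine (hmM.pos_mul_atTop one_pos hM).congr' ?_
    filter_upwards [hM.eventually_gt_atTop 0] with N hN
    field_simp
  -- The correction factor of each term, extended by zero so that the finite kernel becomes a sum
  -- over all pairs.
  set T : ℕ → ℕ × ℕ → ℝ := fun N i => if i.1 < m N ∧ i.2 < m N then
    Real.Gamma ((β + 1 + i.1) / θ + m N) / ((m N - 1 - i.2).factorial : ℝ) *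
      (M N ^ ((β + 1 + i.1) / θ) * M N ^ i.2)⁻¹ *
        ∑ j ∈ Finset.range (m N - i.1), (x / M N ^ (1 / θ)) ^ j / (j.factorial : ℝ) else 0
    with hT
  have hrew : ∀ᶠ N in atTop, ∑' i, limitKernelTerm β θ x y i.1 i.2 * T N i =
      (M N ^ ((β + 1) / θ))⁻¹ *
        laguerreKernel β θ (m N) (x / M N ^ (1 / θ)) (y / M N ^ (1 / θ)) := by
    filter_upwards [hM.eventually_gt_atTop 0] with N hN
    rw [laguerreKernel_eq_sum hβ hθ, ← Finset.sum_product', Finset.mul_sum,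
      tsum_eq_sum (s := Finset.range (m N) ×ˢ Finset.range (m N))]
    · refine Finset.sum_congr rfl fun i hi => ?_
      rw [Finset.mem_product, Finset.mem_range, Finset.mem_range] at hi
      rw [hT]
      simp only [if_pos hi]
      rw [← mul_assoc (M N ^ ((β + 1) / θ))⁻¹, limitKernelTerm_scale hθ hN]
      ring
    · intro i hi
      rw [Finset.mem_product, Finset.mem_range, Finset.mem_range] at hi
      rw [hT]
      simp only [if_neg hi, mul_zero]
  refine Tendsto.congr' hrew ?_
  -- For k < m one has (β + 1 + k)/θ ≤ D m; together with m < 2 M, which holds eventually, Q bounds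
  -- (m + (β + 1 + k)/θ)/M. The majorant is therefore geometric in k and b.
  set D : ℝ := (β + 2) / θ with hD
  have hD0 : 0 < D := div_pos (by linarith) hθ
  set Q : ℝ := 2 * (1 + D) with hQ
  have hQ0 : 0 < Q := by positivity
  refine tendsto_tsum_of_dominated_convergence
    (bound := fun i => Real.exp x * Q ^ ((β + 1) / θ) *
      (|limitKernelTerm β θ x y i.1 i.2| * ((Q ^ (1 / θ)) ^ i.1 * 2 ^ i.2)))
    ((summable_abs_limitKernelTerm_mul_pow hβ hθ x y (by positivity) (by norm_num)).mul_left _)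
    ?_ ?_
  · rintro ⟨k, b⟩
    suffices h : Tendsto (fun N => T N (k, b)) atTop (𝓝 1) by
      simpa using h.const_mul (limitKernelTerm β θ x y k b)
    have hκ : 0 < (β + 1 + k) / θ := by positivity
    have h1 := (tendsto_Gamma_add_div hκ).comp hm
    have h2 := (tendsto_descFactorial_div_pow b).comp hm
    have h3 : Tendsto (fun N => ((m N : ℝ) / M N) ^ ((β + 1 + k) / θ)) atTop (𝓝 1) := by
      simpa using hmM.rpow_const (p := (β + 1 + k) / θ) (Or.inr hκ.le)
    have h4 : Tendsto (fun N => ((m N : ℝ) / M N) ^ b) atTop (𝓝 1) := by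
      simpa using hmM.pow b
    have hMθ : Tendsto (fun N => x / M N ^ (1 / θ)) atTop (𝓝 0) :=
      ((tendsto_rpow_atTop (by positivity)).comp hM).const_div_atTop x
    have h5 := tendsto_sum_pow_div_factorial (r := fun N => m N - k) hMθ
      (by
        filter_upwards [hM.eventually_gt_atTop 0] with N hN
        positivity)
      (by
        filter_upwards [hm.eventually_gt_atTop k] with N hN
        omega)
    have h := (((h1.mul h2).mul h3).mul h4).mul h5
    simp only [mul_one] at h
    refine h.congr' ?_
    filter_upwards [hM.eventually_gt_atTop 0, hm.eventually_gt_atTop k,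
      hm.eventually_gt_atTop b] with N hN hk hb
    have hm0 : (0 : ℝ) < m N := by
      have : 0 < m N := by omega
      exact_mod_cast this
    have hG := Real.Gamma_pos_of_pos hm0
    rw [hT]
    simp only [Function.comp_apply, hk, hb, and_self, if_true]
    rw [← Gamma_natCast_div_factorial hb, Real.div_rpow hm0.le hN.le, div_pow]
    have : 0 < (m N : ℝ) ^ ((β + 1 + k) / θ) := by positivity
    have : 0 < M N ^ ((β + 1 + k) / θ) := by positivity
    field_simp
  · have hle : ∀ᶠ N in atTop, (m N : ℝ) / M N < 2 := hmM.eventually_lt_const (by norm_num)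
    filter_upwards [hle, hM.eventually_ge_atTop 1] with N hN hN1
    rintro ⟨k, b⟩
    have hM0 : 0 < M N := by linarith
    rw [Real.norm_eq_abs, abs_mul]
    suffices h : |T N (k, b)| ≤
        Real.exp x * Q ^ ((β + 1) / θ) * ((Q ^ (1 / θ)) ^ k * 2 ^ b) by
      calc _ ≤ _ := mul_le_mul_of_nonneg_left h (abs_nonneg _)
        _ = _ := by ring
    rw [hT]
    simp only
    split_ifs with hkb
    · obtain ⟨hk, hb⟩ := hkb
      have hκ : 0 < (β + 1 + k) / θ := by positivity
      have hm1 : (1 : ℝ) ≤ m N := by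
        have : 1 ≤ m N := by omega
        exact_mod_cast this
      have hm0 : (0 : ℝ) < m N := by linarith
      have hk' : (k : ℝ) ≤ m N := by exact_mod_cast hk.le
      have hG := Real.Gamma_pos_of_pos hm0
      have hGκ := Real.Gamma_pos_of_pos (add_pos hκ hm0)
      have hκm : (β + 1 + k) / θ ≤ D * m N := by
        rw [hD, div_mul_eq_mul_div]
        gcongr
        nlinarith
      have hdesc : Real.Gamma (m N) / ((m N - 1 - b).factorial : ℝ) ≤ (m N : ℝ) ^ b := by
        rw [Gamma_natCast_div_factorial hb]
        calc (((m N - 1).descFactorial b : ℕ) : ℝ) ≤ (((m N - 1) ^ b : ℕ) : ℝ) := by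
              exact_mod_cast Nat.descFactorial_le_pow _ _
          _ ≤ (m N : ℝ) ^ b := by
              exact_mod_cast Nat.pow_le_pow_left (Nat.sub_le _ _) b
      have hE : ∑ j ∈ Finset.range (m N - k), (x / M N ^ (1 / θ)) ^ j / (j.factorial : ℝ) ≤
          Real.exp x := by
        refine (Real.sum_le_exp_of_nonneg (by positivity) _).trans ?_
        rw [Real.exp_le_exp]
        exact div_le_self hx (Real.one_le_rpow hN1 (by positivity))
      have hMκ : (M N) ^ ((β + 1 + k) / θ) ≠ 0 := by positivity
      have hR : Real.Gamma ((β + 1 + k) / θ + m N) / ((m N - 1 - b).factorial : ℝ) *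
          (M N ^ ((β + 1 + k) / θ) * M N ^ b)⁻¹ ≤ Q ^ ((β + 1 + k) / θ) * 2 ^ b := by
        calc _ ≤ (Real.Gamma (m N) * (m N + (β + 1 + k) / θ) ^ ((β + 1 + k) / θ)) /
              ((m N - 1 - b).factorial : ℝ) * (M N ^ ((β + 1 + k) / θ) * M N ^ b)⁻¹ := by
              gcongr
              exact Gamma_add_le_mul_rpow hm0 hκ
          _ = (Real.Gamma (m N) / ((m N - 1 - b).factorial : ℝ)) *
                (m N + (β + 1 + k) / θ) ^ ((β + 1 + k) / θ) *
                (M N ^ ((β + 1 + k) / θ) * M N ^ b)⁻¹ := by ring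
          _ ≤ (m N : ℝ) ^ b * (m N + (β + 1 + k) / θ) ^ ((β + 1 + k) / θ) *
                (M N ^ ((β + 1 + k) / θ) * M N ^ b)⁻¹ := by gcongr
          _ = ((m N + (β + 1 + k) / θ) / M N) ^ ((β + 1 + k) / θ) * ((m N : ℝ) / M N) ^ b := by
              rw [Real.div_rpow (by positivity) hM0.le, div_pow]
              field_simp
          _ ≤ _ := by
              gcongr
              rw [div_le_iff₀ hM0, hQ]
              rw [div_lt_iff₀ hM0] at hN
              nlinarith
      rw [abs_of_nonneg (by positivity)]
      calc _ ≤ (Q ^ ((β + 1 + k) / θ) * 2 ^ b) * Real.exp x := by gcongr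
        _ = _ := by
          rw [rpow_add_natCast_div hQ0]
          ring
    · rw [abs_zero]
      positivity

/-! ### Bordered determinants and Dyson's integration step. -/

theorem det_updateCol_eq_sum {ι : Type*} [Fintype ι] [DecidableEq ι] (A : Matrix ι ι ℝ) (i : ι)
    (u : ι → ℝ) :
    (A.updateCol i u).det = ∑ j, u j * (A.updateCol i (Pi.single j 1)).det := by
  conv_lhs => rw [← Matrix.cramer_apply, pi_eq_sum_univ' u, map_sum, Finset.sum_apply]
  refine Finset.sum_congr rfl fun j _ => ?_
  rw [map_smul, Pi.smul_apply, Matrix.cramer_apply, smul_eq_mul]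

theorem det_updateRow_eq_sum {ι : Type*} [Fintype ι] [DecidableEq ι] (A : Matrix ι ι ℝ) (i : ι)
    (u : ι → ℝ) :
    (A.updateRow i u).det = ∑ j, u j * (A.updateRow i (Pi.single j 1)).det := by
  simp only [← Matrix.det_transpose (Matrix.updateRow _ _ _), ← Matrix.updateCol_transpose]
  exact det_updateCol_eq_sum _ _ _

/-- The matrix `A` with one column `u`, one row `v` and the corner entry `d` added. -/
def borderedMatrix {ι : Type*} (A : Matrix ι ι ℝ) (u v : ι → ℝ) (d : ℝ) :
    Matrix (ι ⊕ Fin 1) (ι ⊕ Fin 1) ℝ :=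
  Matrix.fromBlocks A (Matrix.of fun i _ => u i) (Matrix.of fun _ j => v j)
    (Matrix.of fun _ _ => d)

theorem det_borderedMatrix {ι : Type*} [Fintype ι] [DecidableEq ι] (A : Matrix ι ι ℝ)
    (u v : ι → ℝ) (d : ℝ) :
    (borderedMatrix A u v d).det =
      d * A.det - ∑ j, ∑ i, A.adjugate j i * (u i * v j) := by
  have hrow : ∀ w e, (borderedMatrix A u v d).updateRow (Sum.inr 0) (Sum.elim w fun _ => e) =
      borderedMatrix A u w e := by
    intro w e
    ext (i | i) (j | j) <;>
      simp [borderedMatrix, Matrix.updateRow_apply, Subsingleton.elim _ (0 : Fin 1)]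
  have h0 := hrow v d
  have hl : ∀ j, (Pi.single (Sum.inl j) 1 : ι ⊕ Fin 1 → ℝ) =
      Sum.elim (Pi.single j 1) fun _ => 0 := by
    intro j
    ext (i | i) <;> simp [Pi.single_apply]
  have hr : ∀ j : Fin 1, (Pi.single (Sum.inr j) 1 : ι ⊕ Fin 1 → ℝ) =
      Sum.elim (0 : ι → ℝ) fun _ => (1 : ℝ) := by
    intro j
    ext (i | i) <;> simp [Subsingleton.elim _ (0 : Fin 1)]
  have hcorner : (borderedMatrix A u 0 1).det = A.det := by
    have : borderedMatrix A u 0 1 = Matrix.fromBlocks A (Matrix.of fun i _ => u i) 0 1 := by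
      ext (i | i) (j | j) <;> simp [borderedMatrix, Subsingleton.elim _ (0 : Fin 1)]
    rw [this, Matrix.det_fromBlocks_zero₂₁, Matrix.det_one, mul_one]
  -- Swapping column j with the border column makes the matrix block triangular, at the cost of a
  -- sign; Cramer's rule then brings in the adjugate.
  have hunit : ∀ j, (borderedMatrix A u (Pi.single j 1) 0).det = -(A.updateCol j u).det := by
    intro j
    have hswap : (borderedMatrix A u (Pi.single j 1) 0).submatrix id
        (Equiv.swap (Sum.inl j) (Sum.inr 0)) =
        Matrix.fromBlocks (A.updateCol j u) (Matrix.of fun i _ => A i j) 0 1 := by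
      ext (i | i) (l | l)
      · by_cases h : l = j
        · subst h
          simp [borderedMatrix]
        · simp [borderedMatrix, h, Equiv.swap_apply_of_ne_of_ne]
      · simp [borderedMatrix, Subsingleton.elim l (0 : Fin 1)]
      · by_cases h : l = j
        · subst h
          simp [borderedMatrix]
        · simp [borderedMatrix, h, Equiv.swap_apply_of_ne_of_ne]
      · simp [borderedMatrix, Subsingleton.elim _ (0 : Fin 1)]
    have h1 := Matrix.det_permute' (Equiv.swap (Sum.inl j) (Sum.inr (0 : Fin 1)))
      (borderedMatrix A u (Pi.single j 1) 0)
    rw [hswap, Matrix.det_fromBlocks_zero₂₁, Matrix.det_one, mul_one,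
      Equiv.Perm.sign_swap (by simp)] at h1
    rw [h1]
    simp
  rw [← h0, det_updateRow_eq_sum, Fintype.sum_sum_type]
  simp only [hl, hr, hrow, hcorner, hunit, Sum.elim_inl, Sum.elim_inr, Finset.univ_unique,
    Finset.sum_singleton]
  have hadj : ∀ j, (A.updateCol j u).det = ∑ i, A.adjugate j i * u i := by
    intro j
    rw [← Matrix.cramer_apply, Matrix.cramer_eq_adjugate_mulVec]
    rfl
  simp only [hadj]
  rw [add_comm, sub_eq_add_neg, ← Finset.sum_neg_distrib]
  congr 1
  refine Finset.sum_congr rfl fun j _ => ?_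
  rw [mul_neg, Finset.mul_sum]
  congr 1
  refine Finset.sum_congr rfl fun i _ => ?_
  ring

/-- Dyson's integration step for a reproducing kernel. -/
theorem integral_det_snoc {X : Type*} [MeasurableSpace X] {μ : Measure X} {K : X → X → ℝ} {c : ℝ}
    (hdiag : Integrable (fun t => K t t) μ) (htrace : ∫ t, K t t ∂μ = c)
    (hmul : ∀ x y, Integrable (fun t => K x t * K t y) μ)
    (hrep : ∀ x y, ∫ t, K x t * K t y ∂μ = K x y) {k : ℕ} (x : Fin k → X) :
    ∫ t, (Matrix.of fun i j : Fin (k + 1) =>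
        K (Fin.snoc (α := fun _ => X) x t i) (Fin.snoc (α := fun _ => X) x t j)).det ∂μ =
      (c - k) * (Matrix.of fun i j => K (x i) (x j)).det := by
  set A : Matrix (Fin k) (Fin k) ℝ := Matrix.of fun i j => K (x i) (x j) with hA
  have hdet : ∀ t, (Matrix.of fun i j : Fin (k + 1) =>
      K (Fin.snoc (α := fun _ => X) x t i) (Fin.snoc (α := fun _ => X) x t j)).det =
      K t t * A.det - ∑ j, ∑ i, A.adjugate j i * (K (x i) t * K t (x j)) := by
    intro t
    rw [← det_borderedMatrix A (fun i => K (x i) t) (fun j => K t (x j)) (K t t),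
      ← Matrix.det_submatrix_equiv_self (finSumFinEquiv (m := k) (n := 1))]
    congr 1
    have hcast : ∀ i : Fin k, Fin.snoc (α := fun _ => X) x t (Fin.castAdd 1 i) = x i :=
      fun i => Fin.snoc_castSucc (α := fun _ => X) t x i
    have hlast : ∀ i : Fin 1, Fin.snoc (α := fun _ => X) x t (Fin.natAdd k i) = t := by
      intro i
      rw [Subsingleton.elim i 0]
      exact Fin.snoc_last (α := fun _ => X) t x
    ext (i | i) (j | j) <;> simp [borderedMatrix, hA, hcast, hlast]
  simp only [hdet]
  have hint : ∀ j, Integrable (fun t => ∑ i, A.adjugate j i * (K (x i) t * K t (x j))) μ :=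
    fun j => integrable_finsetSum _ fun i _ => (hmul _ _).const_mul _
  rw [integral_sub (hdiag.mul_const _) (integrable_finsetSum _ fun j _ => hint j),
    integral_mul_const, htrace, integral_finsetSum _ fun j _ => hint j]
  -- The reproducing property turns the integral into the diagonal entry (adj A · A) j j. The k
  -- values of j together subtract k det A from the trace term c det A.
  have h1 : ∀ j, ∫ t, ∑ i, A.adjugate j i * (K (x i) t * K t (x j)) ∂μ = A.det := by
    intro j
    rw [integral_finsetSum _ fun i _ => (hmul _ _).const_mul _]
    simp only [integral_const_mul, hrep]
    have h2 := congrFun (congrFun (Matrix.adjugate_mul A) j) j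
    simpa [Matrix.mul_apply, hA] using h2
  simp only [h1, Finset.sum_const, Finset.card_univ, Fintype.card_fin, nsmul_eq_mul]
  ring

/-- Integrating out `r` variables of a determinant with a reproducing kernel. -/
theorem integral_det_append {K : ℝ → ℝ → ℝ} {c : ℝ}
    (hdiag : Integrable (fun t => K t t)) (htrace : ∫ t, K t t = c)
    (hmul : ∀ x y, Integrable (fun t => K x t * K t y))
    (hrep : ∀ x y, ∫ t, K x t * K t y = K x y) {n : ℕ} (x : Fin n → ℝ)
    (hint : ∀ r, Integrable fun y : Fin r → ℝ =>
      (Matrix.of fun i j => K (Fin.append x y i) (Fin.append x y j)).det) (r : ℕ) :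
    ∫ y : Fin r → ℝ, (Matrix.of fun i j => K (Fin.append x y i) (Fin.append x y j)).det =
      (∏ i ∈ Finset.range r, (c - (n + i : ℕ))) * (Matrix.of fun i j => K (x i) (x j)).det := by
  induction r with
  | zero =>
    have h : ∀ y : Fin 0 → ℝ, Fin.append x y = x := fun y => by
      ext i
      exact Fin.append_left x y i
    simp only [h, Finset.range_zero, Finset.prod_empty, one_mul]
    rw [integral_unique]
    simp [measureReal_def, volume_pi]
  | succ r ih =>
    have hmp := (volume_preserving_piFinSuccAbove (fun _ : Fin (r + 1) => ℝ) (Fin.last r)).symm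
    have hsymm : ∀ p : ℝ × (Fin r → ℝ),
        (MeasurableEquiv.piFinSuccAbove (fun _ : Fin (r + 1) => ℝ) (Fin.last r)).symm p =
          Fin.snoc (α := fun _ => ℝ) p.2 p.1 := fun p =>
      Fin.insertNth_last' p.1 p.2
    rw [← hmp.integral_comp (MeasurableEquiv.measurableEmbedding _)]
    have hint' := (hmp.integrable_comp_emb (MeasurableEquiv.measurableEmbedding _)).mpr
      (hint (r + 1))
    simp only [Function.comp_def] at hint'
    rw [Measure.volume_eq_prod, integral_prod_symm _ hint']
    simp only [hsymm]
    have hstep : ∀ y : Fin r → ℝ, ∫ t, (Matrix.of fun i j =>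
        K (Fin.append x (Fin.snoc (α := fun _ => ℝ) y t) i)
          (Fin.append x (Fin.snoc (α := fun _ => ℝ) y t) j)).det =
        (c - (n + r : ℕ)) *
          (Matrix.of fun i j => K (Fin.append x y i) (Fin.append x y j)).det := by
      intro y
      rw [← integral_det_snoc hdiag htrace hmul hrep (Fin.append x y)]
      refine integral_congr_ae (Eventually.of_forall fun t => ?_)
      have := Fin.append_snoc x y t
      simp only [this]
      rfl
    simp only [hstep]
    rw [integral_const_mul, ih, Finset.prod_range_succ]
    ring

/-- In the Leibniz expansion each variable occurs once as a first and once as a second argument of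
K. Regrouped by variable, every term is a product of one-variable functions p i * q j, so
integrability of these products suffices. -/
theorem integrable_det_append_of_finite_rank {K : ℝ → ℝ → ℝ} {s : Finset ℕ} {p q : ℕ → ℝ → ℝ}
    (hK : ∀ x y, K x y = ∑ j ∈ s, p j x * q j y)
    (hpq : ∀ i j, Integrable fun t => p i t * q j t) {n r : ℕ} (x : Fin n → ℝ) :
    Integrable fun y : Fin r → ℝ =>
      (Matrix.of fun i j => K (Fin.append x y i) (Fin.append x y j)).det := by
  have hdet : ∀ z : Fin (n + r) → ℝ, (Matrix.of fun i j => K (z i) (z j)).det =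
      ∑ σ : Equiv.Perm (Fin (n + r)), ((Equiv.Perm.sign σ : ℤ) : ℝ) *
        ∑ f ∈ Fintype.piFinset fun _ : Fin (n + r) => s,
          ∏ i, p (f (σ.symm i)) (z i) * q (f i) (z i) := by
    intro z
    rw [Matrix.det_apply']
    refine Finset.sum_congr rfl fun σ _ => ?_
    simp only [Matrix.of_apply, hK]
    rw [Finset.prod_univ_sum]
    congr 1
    refine Finset.sum_congr rfl fun f _ => ?_
    rw [Finset.prod_mul_distrib, Finset.prod_mul_distrib]
    congr 1
    rw [← Equiv.prod_comp σ (fun i => p (f (σ.symm i)) (z i))]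
    simp only [Equiv.symm_apply_apply]
  simp only [hdet, Fin.prod_univ_add, Fin.append_left, Fin.append_right]
  refine integrable_finsetSum _ fun σ _ => Integrable.const_mul ?_ _
  refine integrable_finsetSum _ fun f _ => Integrable.const_mul ?_ _
  exact Integrable.fintype_prod fun i => hpq _ _

/-! ### Moments of the Hermite weight and the splitting by parity. -/

noncomputable section

/-- The one-point weight `|x|^α e^{-x²}`. -/
def hermiteBaseWeight (α x : ℝ) : ℝ := |x| ^ α * Real.exp (-x ^ 2)

/-- The Gram matrix of the powers `x ^ j` and `(x ^ ⟨θ⟩) ^ k`. -/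
def hermiteGram (α θ : ℝ) (k j : ℕ) : ℝ :=
  if j % 2 = k % 2 then Real.Gamma ((j + θ * k + α + 1) / 2) else 0

/-- The entries of the inverse of the `N × N` Gram matrix. -/
def hermiteCoeff (α θ : ℝ) (N j k : ℕ) : ℝ :=
  if j % 2 = k % 2 then
    if j % 2 = 0 then laguerreCoeff ((α - 1) / 2) θ ((N + 1) / 2) (j / 2) (k / 2)
    else laguerreCoeff ((α + θ) / 2) θ (N / 2) (j / 2) (k / 2)
  else 0

/-- The functions biorthogonal to the powers `x ^ j`, `j < N`. -/
def hermiteDual (α θ : ℝ) (N j : ℕ) (y : ℝ) : ℝ :=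
  ∑ k ∈ Finset.range N, hermiteCoeff α θ N j k * spow θ y ^ k

/-- The Christoffel–Darboux kernel, without weight, of the biorthogonal Hermite ensemble. -/
def hermiteKernel (α θ : ℝ) (N : ℕ) (x y : ℝ) : ℝ :=
  ∑ j ∈ Finset.range N, x ^ j * hermiteDual α θ N j y

end

theorem spow_neg (θ x : ℝ) : spow θ (-x) = -spow θ x := by
  rw [spow, spow, Real.sign_neg, abs_neg, neg_mul]

theorem spow_of_nonneg {θ x : ℝ} (hθ : 0 < θ) (hx : 0 ≤ x) : spow θ x = x ^ θ := by
  rcases hx.eq_or_lt with rfl | h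
  · simp [spow, Real.zero_rpow hθ.ne']
  · rw [spow, Real.sign_of_pos h, abs_of_pos h, one_mul]

theorem monotone_spow {θ : ℝ} (hθ : 0 < θ) : Monotone (spow θ) := by
  have key : ∀ x y : ℝ, 0 ≤ x → x ≤ y → spow θ x ≤ spow θ y := fun x y hx hxy => by
    rw [spow_of_nonneg hθ hx, spow_of_nonneg hθ (hx.trans hxy)]
    exact Real.rpow_le_rpow hx hxy hθ.le
  have hz : spow θ 0 = 0 := by simp [spow]
  intro x y hxy
  rcases le_total 0 x with hx | hx
  · exact key x y hx hxy
  · have hx' := key 0 (-x) le_rfl (by linarith)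
    rw [hz, spow_neg] at hx'
    rcases le_total 0 y with hy | hy
    · have hy' := key 0 y le_rfl hy
      rw [hz] at hy'
      linarith
    · have h := key (-y) (-x) (by linarith) (by linarith)
      rw [spow_neg, spow_neg] at h
      linarith

theorem spow_sq {θ : ℝ} (hθ : 0 < θ) (y : ℝ) : spow θ (y ^ 2) = spow θ y ^ 2 := by
  rw [spow_of_nonneg hθ (sq_nonneg y)]
  rcases eq_or_ne y 0 with rfl | hy
  · simp [spow, Real.zero_rpow hθ.ne']
  · have hs : Real.sign y ^ 2 = 1 := by
      rcases Real.sign_apply_eq_of_ne_zero y hy with h | h <;> simp [h]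
    rw [spow, mul_pow, hs, one_mul, ← sq_abs y, ← Real.rpow_natCast, ← Real.rpow_natCast,
      ← Real.rpow_mul (abs_nonneg y), ← Real.rpow_mul (abs_nonneg y), mul_comm]

theorem measurable_spow (θ : ℝ) : Measurable (spow θ) := by
  have hs : Measurable Real.sign :=
    Measurable.ite measurableSet_Iio measurable_const
      (Measurable.ite measurableSet_Ioi measurable_const measurable_const)
  exact hs.mul (measurable_id.abs.pow_const θ)

theorem measurable_hermiteBaseWeight (α : ℝ) : Measurable (hermiteBaseWeight α) := by
  unfold hermiteBaseWeight
  exact (measurable_id.abs.pow_const α).mul (by fun_prop)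

theorem integral_abs_rpow_mul_exp {p : ℝ} (hp : -1 < p) :
    ∫ x : ℝ, |x| ^ p * Real.exp (-|x| ^ 2) = Real.Gamma ((p + 1) / 2) := by
  rw [integral_comp_abs (f := fun x => x ^ p * Real.exp (-x ^ 2))]
  have h := integral_rpow_mul_exp_neg_rpow (p := 2) (q := p) two_pos hp
  simp only [Real.rpow_two] at h
  rw [h]
  ring

theorem integrable_abs_rpow_mul_exp {p : ℝ} (hp : -1 < p) :
    Integrable fun x : ℝ => |x| ^ p * Real.exp (-|x| ^ 2) := by
  -- The integral of a non-integrable function is 0 by convention, so the nonzero Gamma value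
  -- already proves integrability.
  refine Integrable.of_integral_ne_zero ?_
  rw [integral_abs_rpow_mul_exp hp]
  exact (Real.Gamma_pos_of_pos (by linarith)).ne'

theorem hermite_moment_eq {α θ x : ℝ} (hx : x ≠ 0) (j k : ℕ) :
    hermiteBaseWeight α x * (x ^ j * spow θ x ^ k) =
      Real.sign x ^ (j + k) * (|x| ^ (j + θ * k + α) * Real.exp (-|x| ^ 2)) := by
  have hx' : 0 < |x| := abs_pos.mpr hx
  have hs : x = Real.sign x * |x| := by
    rcases lt_or_gt_of_ne hx with h | h
    · rw [Real.sign_of_neg h, abs_of_neg h]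
      ring
    · rw [Real.sign_of_pos h, abs_of_pos h]
      ring
  have hpow : x ^ j = Real.sign x ^ j * |x| ^ j := by
    conv_lhs => rw [hs]
    rw [mul_pow]
  rw [hermiteBaseWeight, spow, mul_pow, hpow, Real.rpow_add hx', Real.rpow_add hx',
    Real.rpow_natCast, Real.rpow_mul hx'.le, Real.rpow_natCast, sq_abs, pow_add]
  ring

theorem moment_exponent_gt {α θ : ℝ} (hα : -1 < α) (hθ : 0 < θ) (j k : ℕ) :
    -1 < j + θ * k + α := by
  have : 0 ≤ θ * k := by positivity
  have : (0 : ℝ) ≤ j := by positivity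
  linarith

theorem integrable_hermite_moment {α θ : ℝ} (hα : -1 < α) (hθ : 0 < θ) (j k : ℕ) :
    Integrable fun x : ℝ => hermiteBaseWeight α x * (x ^ j * spow θ x ^ k) := by
  refine (integrable_abs_rpow_mul_exp (moment_exponent_gt hα hθ j k)).mono' ?_ ?_
  · exact ((measurable_hermiteBaseWeight α).mul ((measurable_id.pow_const j).mul
      ((measurable_spow θ).pow_const k))).aestronglyMeasurable
  · filter_upwards [Measure.ae_ne volume (0 : ℝ)] with x hx
    rw [hermite_moment_eq hx, norm_mul, norm_pow, Real.norm_eq_abs (Real.sign x)]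
    have hs : |Real.sign x| = 1 := by
      rcases Real.sign_apply_eq_of_ne_zero x hx with h | h <;> simp [h]
    rw [hs, one_pow, one_mul, Real.norm_of_nonneg (by positivity)]

theorem integral_hermite_moment {α θ : ℝ} (hα : -1 < α) (hθ : 0 < θ) (j k : ℕ) :
    ∫ x : ℝ, hermiteBaseWeight α x * (x ^ j * spow θ x ^ k) = hermiteGram α θ k j := by
  rw [hermiteGram]
  split_ifs with hjk
  · rw [← integral_abs_rpow_mul_exp (moment_exponent_gt hα hθ j k)]
    refine integral_congr_ae ?_
    filter_upwards [Measure.ae_ne volume (0 : ℝ)] with x hx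
    obtain ⟨r, hr⟩ : Even (j + k) := by
      rw [Nat.even_iff]
      omega
    have hs : Real.sign x * Real.sign x = 1 := by
      rcases Real.sign_apply_eq_of_ne_zero x hx with h | h <;> simp [h]
    rw [hermite_moment_eq hx, hr, pow_add, ← mul_pow, hs, one_pow, one_mul]
  · have hodd : Odd (j + k) := by
      rw [Nat.odd_iff]
      omega
    have h := integral_neg_eq_self
      (fun x : ℝ => hermiteBaseWeight α x * (x ^ j * spow θ x ^ k)) volume
    have h2 : ∀ x : ℝ, hermiteBaseWeight α (-x) * ((-x) ^ j * spow θ (-x) ^ k) =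
        -(hermiteBaseWeight α x * (x ^ j * spow θ x ^ k)) := fun x => by
      have h1 : (-1 : ℝ) ^ j * (-1) ^ k = -1 := by rw [← pow_add, hodd.neg_one_pow]
      rw [spow_neg, hermiteBaseWeight, hermiteBaseWeight, abs_neg, neg_sq, neg_pow x,
        neg_pow (spow θ x)]
      linear_combination (|x| ^ α * Real.exp (-x ^ 2) * x ^ j * spow θ x ^ k) * h1
    simp only [h2, integral_neg] at h
    linarith

theorem sum_range_even_odd (f : ℕ → ℝ) (N : ℕ) :
    ∑ j ∈ Finset.range N, f j = ∑ a ∈ Finset.range ((N + 1) / 2), f (2 * a) +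
      ∑ a ∈ Finset.range (N / 2), f (2 * a + 1) := by
  induction N with
  | zero => simp
  | succ N ih =>
    rw [Finset.sum_range_succ, ih]
    rcases Nat.even_or_odd' N with ⟨c, rfl | rfl⟩
    · have h1 : (2 * c + 1 + 1) / 2 = c + 1 := by omega
      have h2 : (2 * c + 1) / 2 = c := by omega
      have h3 : 2 * c / 2 = c := by omega
      rw [h1, h2, h3, Finset.sum_range_succ]
      ring
    · have h1 : (2 * c + 1 + 1 + 1) / 2 = c + 1 := by omega
      have h2 : (2 * c + 1 + 1) / 2 = c + 1 := by omega
      have h3 : (2 * c + 1) / 2 = c := by omega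
      rw [h1, h2, h3, Finset.sum_range_succ (fun a => f (2 * a + 1))]
      ring

/-- With j = 2a, k = 2c the Gram entry is Γ(a + (α - 1)/2 + 1 + θ c); with j = 2a + 1, k = 2c + 1 it
is Γ(a + (α + θ)/2 + 1 + θ c). Each parity class is thus a Laguerre Gram matrix, already inverted.
-/
theorem sum_hermiteGram_mul_hermiteCoeff {α θ : ℝ} (hα : -1 < α) (hθ : 0 < θ) {N k k' : ℕ}
    (hk : k < N) (hk' : k' < N) :
    ∑ j ∈ Finset.range N, hermiteGram α θ k j * hermiteCoeff α θ N j k' =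
      if k = k' then 1 else 0 := by
  have hβ : -1 < (α - 1) / 2 := by linarith
  have hβ' : -1 < (α + θ) / 2 := by linarith
  have e1 : ∀ a, 2 * a % 2 = 0 := fun a => by omega
  have e2 : ∀ a, 2 * a / 2 = a := fun a => by omega
  have o1 : ∀ a, (2 * a + 1) % 2 = 1 := fun a => by omega
  have o2 : ∀ a, (2 * a + 1) / 2 = a := fun a => by omega
  rw [sum_range_even_odd]
  rcases Nat.even_or_odd' k with ⟨c, rfl | rfl⟩ <;> rcases Nat.even_or_odd' k' with ⟨d, rfl | rfl⟩
  · have h := sum_laguerreCoeff_mul_Gamma hβ hθ (m := (N + 1) / 2) (b := d) (b' := c)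
      (by omega) (by omega)
    have h' : (2 * c = 2 * d) ↔ (d = c) := by omega
    simp only [hermiteGram, hermiteCoeff, e1, e2, o1, one_ne_zero, if_true, if_false, zero_mul,
      Finset.sum_const_zero, add_zero, h']
    rw [← h]
    refine Finset.sum_congr rfl fun a _ => ?_
    rw [mul_comm, laguerreNode]
    congr 2
    push_cast
    ring
  · have h' : ¬ (2 * c = 2 * d + 1) := by omega
    simp [hermiteGram, hermiteCoeff, h']
  · have h' : ¬ (2 * c + 1 = 2 * d) := by omega
    simp [hermiteGram, hermiteCoeff, h']
  · have h := sum_laguerreCoeff_mul_Gamma hβ' hθ (m := N / 2) (b := d) (b' := c)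
      (by omega) (by omega)
    have h' : (2 * c + 1 = 2 * d + 1) ↔ (d = c) := by omega
    simp only [hermiteGram, hermiteCoeff, e1, o1, o2, zero_ne_one, one_ne_zero, if_true, if_false,
      zero_mul, Finset.sum_const_zero, zero_add, h']
    rw [← h]
    refine Finset.sum_congr rfl fun a _ => ?_
    rw [mul_comm, laguerreNode]
    congr 2
    push_cast
    ring

theorem hermiteKernel_eq_laguerreKernel {α θ : ℝ} (hθ : 0 < θ) (N : ℕ) (x y : ℝ) :
    hermiteKernel α θ N x y =
      laguerreKernel ((α - 1) / 2) θ ((N + 1) / 2) (x ^ 2) (y ^ 2) +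
        x * spow θ y * laguerreKernel ((α + θ) / 2) θ (N / 2) (x ^ 2) (y ^ 2) := by
  have e1 : ∀ a, 2 * a % 2 = 0 := fun a => by omega
  have e2 : ∀ a, 2 * a / 2 = a := fun a => by omega
  have o1 : ∀ a, (2 * a + 1) % 2 = 1 := fun a => by omega
  have o2 : ∀ a, (2 * a + 1) / 2 = a := fun a => by omega
  rw [hermiteKernel, sum_range_even_odd]
  simp only [hermiteDual, sum_range_even_odd (fun k => hermiteCoeff α θ N _ k * spow θ y ^ k)]
  simp only [hermiteCoeff, e1, e2, o1, o2, zero_ne_one, one_ne_zero, if_true, if_false, zero_mul,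
    Finset.sum_const_zero, add_zero, zero_add]
  congr 1
  · rw [laguerreKernel]
    refine Finset.sum_congr rfl fun a _ => ?_
    rw [Finset.mul_sum]
    refine Finset.sum_congr rfl fun b _ => ?_
    rw [spow_sq hθ, ← pow_mul, ← pow_mul]
    ring
  · rw [laguerreKernel, Finset.mul_sum]
    refine Finset.sum_congr rfl fun a _ => ?_
    rw [Finset.mul_sum, Finset.mul_sum]
    refine Finset.sum_congr rfl fun b _ => ?_
    rw [spow_sq hθ, ← pow_mul, ← pow_mul]
    ring

theorem hermiteCoeff_matrix_mul_hermiteGram_matrix {α θ : ℝ} (hα : -1 < α) (hθ : 0 < θ) (N : ℕ) :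
    (Matrix.of fun j k : Fin N => hermiteCoeff α θ N j k) *
      (Matrix.of fun k j : Fin N => hermiteGram α θ k j) = 1 := by
  rw [mul_eq_one_comm]
  ext k k'
  rw [Matrix.mul_apply, Matrix.one_apply]
  simp only [Matrix.of_apply]
  rw [Finset.sum_range (fun j => hermiteGram α θ k j * hermiteCoeff α θ N j k') |>.symm,
    sum_hermiteGram_mul_hermiteCoeff hα hθ k.2 k'.2]
  simp only [Fin.val_inj]

theorem hermiteDual_moment_eq (α θ : ℝ) (N i j : ℕ) (x : ℝ) :
    hermiteBaseWeight α x * (x ^ j * hermiteDual α θ N i x) =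
      ∑ k ∈ Finset.range N, hermiteCoeff α θ N i k *
        (hermiteBaseWeight α x * (x ^ j * spow θ x ^ k)) := by
  rw [hermiteDual, Finset.mul_sum, Finset.mul_sum]
  refine Finset.sum_congr rfl fun k _ => ?_
  ring

theorem integrable_hermiteDual_moment {α θ : ℝ} (hα : -1 < α) (hθ : 0 < θ) (N i j : ℕ) :
    Integrable fun x : ℝ => hermiteBaseWeight α x * (x ^ j * hermiteDual α θ N i x) := by
  simp only [hermiteDual_moment_eq]
  exact integrable_finsetSum _ fun k _ => (integrable_hermite_moment hα hθ j k).const_mul _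

theorem integral_hermiteDual_moment {α θ : ℝ} (hα : -1 < α) (hθ : 0 < θ) {N i j : ℕ}
    (hi : i < N) (hj : j < N) :
    ∫ x : ℝ, hermiteBaseWeight α x * (x ^ j * hermiteDual α θ N i x) =
      if i = j then 1 else 0 := by
  simp only [hermiteDual_moment_eq]
  rw [integral_finsetSum _ fun k _ => (integrable_hermite_moment hα hθ j k).const_mul _]
  simp only [integral_const_mul, integral_hermite_moment hα hθ]
  have h := congrFun (congrFun (hermiteCoeff_matrix_mul_hermiteGram_matrix hα hθ N) ⟨i, hi⟩) ⟨j, hj⟩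
  rw [Matrix.mul_apply, Matrix.one_apply] at h
  simp only [Matrix.of_apply, Fin.mk.injEq] at h
  rw [← h, Finset.sum_range]

/-! ### Determinantal structure of the Hermite ensemble. -/

theorem hermiteWeight_nonneg {θ : ℝ} (hθ : 0 < θ) (α : ℝ) {N : ℕ} (x : Fin N → ℝ) :
    0 ≤ hermiteWeight α θ x := by
  refine mul_nonneg (Finset.prod_nonneg fun i _ => by positivity)
    (Finset.prod_nonneg fun i _ => Finset.prod_nonneg fun j _ => ?_)
  rcases le_total (x i) (x j) with h | h
  · exact mul_nonneg_of_nonpos_of_nonpos (sub_nonpos.mpr h)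
      (sub_nonpos.mpr (monotone_spow hθ h))
  · exact mul_nonneg (sub_nonneg.mpr h) (sub_nonneg.mpr (monotone_spow hθ h))

theorem hermiteWeight_eq_vandermonde (α θ : ℝ) {N : ℕ} (x : Fin N → ℝ) :
    hermiteWeight α θ x = (∏ i, hermiteBaseWeight α (x i)) *
      ((Matrix.vandermonde x).det * (Matrix.vandermonde fun i => spow θ (x i)).det) := by
  rw [hermiteWeight, Matrix.det_vandermonde, Matrix.det_vandermonde]
  congr 1
  rw [← Finset.prod_mul_distrib]
  refine Finset.prod_congr rfl fun i _ => ?_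
  rw [← Finset.prod_mul_distrib]
  refine Finset.prod_congr rfl fun j _ => ?_
  ring

theorem hermiteWeight_comp_cast (α θ : ℝ) {N N' : ℕ} (h : N' = N) (x : Fin N → ℝ) :
    hermiteWeight α θ (x ∘ Fin.cast h) = hermiteWeight α θ x := by
  subst h
  rfl

/-- The determinant of the Gram matrix. -/
noncomputable def hermiteGramDet (α θ : ℝ) (N : ℕ) : ℝ :=
  (Matrix.of fun k j : Fin N => hermiteGram α θ k j).det

/-- The weighted correlation kernel of the biorthogonal Hermite ensemble. -/
noncomputable def hermiteWeightedKernel (α θ : ℝ) (N : ℕ) (x y : ℝ) : ℝ :=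
  hermiteBaseWeight α x * hermiteKernel α θ N x y

/-- The kernel matrix factors as weight times Vandermonde times inverse Gram matrix times transposed
Vandermonde, so its determinant is the density divided by the Gram determinant. -/
theorem hermiteWeight_eq_det {α θ : ℝ} (hα : -1 < α) (hθ : 0 < θ) {N : ℕ} (x : Fin N → ℝ) :
    hermiteWeight α θ x = hermiteGramDet α θ N *
      (Matrix.of fun i j => hermiteWeightedKernel α θ N (x i) (x j)).det := by
  have h1 : (Matrix.of fun i j => hermiteWeightedKernel α θ N (x i) (x j)) =
      Matrix.of fun i j => hermiteBaseWeight α (x i) *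
        (Matrix.vandermonde x * (Matrix.of fun j k : Fin N => hermiteCoeff α θ N j k) *
          (Matrix.vandermonde fun i => spow θ (x i)).transpose) i j := by
    ext i j
    rw [Matrix.mul_assoc]
    simp only [Matrix.of_apply, Matrix.mul_apply, hermiteWeightedKernel, hermiteKernel,
      hermiteDual, Matrix.vandermonde_apply, Matrix.transpose_apply, Finset.sum_range]
  have h2 := congrArg Matrix.det (hermiteCoeff_matrix_mul_hermiteGram_matrix hα hθ N)
  rw [Matrix.det_mul, Matrix.det_one] at h2
  rw [h1, Matrix.det_mul_column, Matrix.det_mul, Matrix.det_mul, Matrix.det_transpose,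
    hermiteWeight_eq_vandermonde, hermiteGramDet]
  linear_combination (-(∏ i, hermiteBaseWeight α (x i)) *
      ((Matrix.vandermonde x).det * (Matrix.vandermonde fun i => spow θ (x i)).det)) * h2

theorem hermiteGramDet_ne_zero {α θ : ℝ} (hα : -1 < α) (hθ : 0 < θ) (N : ℕ) :
    hermiteGramDet α θ N ≠ 0 := by
  have h2 := congrArg Matrix.det (hermiteCoeff_matrix_mul_hermiteGram_matrix hα hθ N)
  rw [Matrix.det_mul, Matrix.det_one] at h2
  exact right_ne_zero_of_mul_eq_one h2

theorem hermiteWeightedKernel_eq_sum (α θ : ℝ) (N : ℕ) (x y : ℝ) :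
    hermiteWeightedKernel α θ N x y =
      ∑ j ∈ Finset.range N, hermiteBaseWeight α x * (x ^ j * hermiteDual α θ N j y) := by
  rw [hermiteWeightedKernel, hermiteKernel, Finset.mul_sum]

theorem integrable_hermiteWeightedKernel_diag {α θ : ℝ} (hα : -1 < α) (hθ : 0 < θ) (N : ℕ) :
    Integrable fun t => hermiteWeightedKernel α θ N t t := by
  simp only [hermiteWeightedKernel_eq_sum]
  exact integrable_finsetSum _ fun j _ => integrable_hermiteDual_moment hα hθ N j j

theorem integral_hermiteWeightedKernel_diag {α θ : ℝ} (hα : -1 < α) (hθ : 0 < θ) (N : ℕ) :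
    ∫ t, hermiteWeightedKernel α θ N t t = N := by
  simp only [hermiteWeightedKernel_eq_sum]
  rw [integral_finsetSum _ fun j _ => integrable_hermiteDual_moment hα hθ N j j]
  calc _ = ∑ j ∈ Finset.range N, (1 : ℝ) := Finset.sum_congr rfl fun j hj => by
        rw [integral_hermiteDual_moment hα hθ (Finset.mem_range.mp hj) (Finset.mem_range.mp hj),
          if_pos rfl]
    _ = N := by simp

theorem hermiteWeightedKernel_mul (α θ : ℝ) (N : ℕ) (x y t : ℝ) :
    hermiteWeightedKernel α θ N x t * hermiteWeightedKernel α θ N t y =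
      ∑ i ∈ Finset.range N, ∑ j ∈ Finset.range N,
        (hermiteBaseWeight α x * (x ^ i * hermiteDual α θ N j y)) *
          (hermiteBaseWeight α t * (t ^ j * hermiteDual α θ N i t)) := by
  rw [hermiteWeightedKernel_eq_sum, hermiteWeightedKernel_eq_sum, Finset.sum_mul_sum]
  refine Finset.sum_congr rfl fun i _ => Finset.sum_congr rfl fun j _ => ?_
  ring

theorem integrable_hermiteWeightedKernel_mul {α θ : ℝ} (hα : -1 < α) (hθ : 0 < θ) (N : ℕ)
    (x y : ℝ) :
    Integrable fun t => hermiteWeightedKernel α θ N x t * hermiteWeightedKernel α θ N t y := by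
  simp only [hermiteWeightedKernel_mul]
  exact integrable_finsetSum _ fun i _ => integrable_finsetSum _ fun j _ =>
    (integrable_hermiteDual_moment hα hθ N i j).const_mul _

theorem integral_hermiteWeightedKernel_mul {α θ : ℝ} (hα : -1 < α) (hθ : 0 < θ) (N : ℕ)
    (x y : ℝ) :
    ∫ t, hermiteWeightedKernel α θ N x t * hermiteWeightedKernel α θ N t y =
      hermiteWeightedKernel α θ N x y := by
  have hint := integrable_hermiteDual_moment hα hθ N
  simp only [hermiteWeightedKernel_mul]
  rw [integral_finsetSum _ fun i _ => integrable_finsetSum _ fun j _ => (hint i j).const_mul _,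
    hermiteWeightedKernel_eq_sum]
  refine Finset.sum_congr rfl fun i hi => ?_
  rw [integral_finsetSum _ fun j _ => (hint i j).const_mul _]
  simp only [integral_const_mul]
  rw [Finset.sum_eq_single_of_mem i hi]
  · rw [integral_hermiteDual_moment hα hθ (Finset.mem_range.mp hi) (Finset.mem_range.mp hi),
      if_pos rfl, mul_one]
  · intro j hj hji
    rw [integral_hermiteDual_moment hα hθ (Finset.mem_range.mp hi) (Finset.mem_range.mp hj),
      if_neg hji.symm, mul_zero]

theorem integrable_det_hermiteWeightedKernel_append {α θ : ℝ} (hα : -1 < α) (hθ : 0 < θ) (N : ℕ)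
    {n r : ℕ} (x : Fin n → ℝ) :
    Integrable fun y : Fin r → ℝ => (Matrix.of fun i j =>
      hermiteWeightedKernel α θ N (Fin.append x y i) (Fin.append x y j)).det := by
  refine integrable_det_append_of_finite_rank (s := Finset.range N)
    (p := fun j x => hermiteBaseWeight α x * x ^ j) (q := fun j y => hermiteDual α θ N j y)
    (fun x y => ?_) (fun i j => ?_) x
  · rw [hermiteWeightedKernel_eq_sum]
    exact Finset.sum_congr rfl fun j _ => (mul_assoc _ _ _).symm
  · simpa only [mul_assoc] using integrable_hermiteDual_moment hα hθ N j i

theorem integrable_hermiteWeight_append {α θ : ℝ} (hα : -1 < α) (hθ : 0 < θ) {n r : ℕ}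
    (x : Fin n → ℝ) :
    Integrable fun y : Fin r → ℝ => hermiteWeight α θ (Fin.append x y) := by
  simp only [hermiteWeight_eq_det hα hθ]
  exact (integrable_det_hermiteWeightedKernel_append hα hθ _ x).const_mul _

theorem integral_hermiteWeight_append {α θ : ℝ} (hα : -1 < α) (hθ : 0 < θ) {n r : ℕ}
    (x : Fin n → ℝ) :
    ∫ y : Fin r → ℝ, hermiteWeight α θ (Fin.append x y) =
      hermiteGramDet α θ (n + r) * (r.factorial *
        (Matrix.of fun i j => hermiteWeightedKernel α θ (n + r) (x i) (x j)).det) := by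
  simp only [hermiteWeight_eq_det hα hθ]
  rw [integral_const_mul, integral_det_append
    (integrable_hermiteWeightedKernel_diag hα hθ (n + r))
    (integral_hermiteWeightedKernel_diag hα hθ (n + r))
    (integrable_hermiteWeightedKernel_mul hα hθ (n + r))
    (integral_hermiteWeightedKernel_mul hα hθ (n + r)) x
    (fun r' => integrable_det_hermiteWeightedKernel_append hα hθ (n + r) x)]
  -- The trace is n + r, so the factors (n + r) - (n + i) for i < r multiply to r!.
  congr 2
  rw [← Nat.descFactorial_self r, Nat.descFactorial_eq_prod_range, Nat.cast_prod]
  refine Finset.prod_congr rfl fun i hi => ?_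
  rw [Nat.cast_sub (Finset.mem_range.mp hi).le]
  push_cast
  ring

theorem integrable_hermiteWeight {α θ : ℝ} (hα : -1 < α) (hθ : 0 < θ) (N : ℕ) :
    Integrable fun x : Fin N → ℝ => hermiteWeight α θ x := by
  have h := integrable_hermiteWeight_append hα hθ (r := N) (Fin.elim0 : Fin 0 → ℝ)
  simpa only [Fin.elim0_append, hermiteWeight_comp_cast] using h

theorem hermitePartition_eq {α θ : ℝ} (hα : -1 < α) (hθ : 0 < θ) (N : ℕ) :
    hermitePartition α θ N = hermiteGramDet α θ N * N.factorial := by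
  have h := integral_hermiteWeight_append hα hθ (r := N) (Fin.elim0 : Fin 0 → ℝ)
  simp only [Fin.elim0_append, hermiteWeight_comp_cast, Matrix.det_isEmpty, mul_one,
    zero_add] at h
  exact h

/-- The density is nonnegative because x and `spow θ x` are ordered alike; the integral is nonzero
because the Gram matrix is invertible. -/
theorem hermitePartition_pos {α θ : ℝ} (hα : -1 < α) (hθ : 0 < θ) (N : ℕ) :
    0 < hermitePartition α θ N := by
  refine lt_of_le_of_ne (integral_nonneg fun x => hermiteWeight_nonneg hθ α x) (Ne.symm ?_)
  rw [hermitePartition_eq hα hθ]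
  exact mul_ne_zero (hermiteGramDet_ne_zero hα hθ N) (by positivity)

theorem integrable_hermiteDensity_append {α θ : ℝ} (hα : -1 < α) (hθ : 0 < θ) {n r : ℕ}
    (x : Fin n → ℝ) :
    Integrable fun y : Fin r → ℝ => hermiteDensity α θ (Fin.append x y) :=
  (integrable_hermiteWeight_append hα hθ x).const_mul _

/-- The correlation functions are determinantal. -/
theorem hermiteCorrelation_eq_det {α θ : ℝ} (hα : -1 < α) (hθ : 0 < θ) {n N : ℕ} (hn : n ≤ N)
    (x : Fin n → ℝ) :
    hermiteCorrelation α θ n N x =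
      (Matrix.of fun i j => hermiteWeightedKernel α θ N (x i) (x j)).det := by
  obtain ⟨r, rfl⟩ := Nat.exists_eq_add_of_le hn
  have hr : n + r - n = r := Nat.add_sub_cancel_left _ _
  rw [hermiteCorrelation, hr]
  simp only [hermiteDensity]
  rw [integral_const_mul, integral_hermiteWeight_append hα hθ, hermitePartition_eq hα hθ]
  have h := Nat.factorial_mul_descFactorial hn
  rw [hr] at h
  have h' : ((n + r).factorial : ℝ) = r.factorial * (n + r).descFactorial n := by
    exact_mod_cast h.symm
  have hG := hermiteGramDet_ne_zero hα hθ (n + r)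
  have h1 : (r.factorial : ℝ) ≠ 0 := by positivity
  have h2 : ((n + r).descFactorial n : ℝ) ≠ 0 := by
    intro h0
    rw [h0, mul_zero] at h'
    exact (by positivity : ((n + r).factorial : ℝ) ≠ 0) h'
  rw [h']
  field_simp

/-! ### The scaling limit of the Hermite kernel and of the correlation functions. -/

theorem tendsto_div_half_of_abs_sub_le {m : ℕ → ℕ} (hm : ∀ N, |(m N : ℝ) - N / 2| ≤ 1 / 2) :
    Tendsto (fun N : ℕ => (m N : ℝ) / ((N : ℝ) / 2)) atTop (𝓝 1) := by
  have h : Tendsto (fun N : ℕ => (m N : ℝ) / ((N : ℝ) / 2) - 1) atTop (𝓝 0) := by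
    refine squeeze_zero_norm' ?_ (tendsto_const_div_atTop_nhds_zero_nat (1 : ℝ))
    filter_upwards [eventually_gt_atTop 0] with N hN
    have hN' : (0 : ℝ) < N := by exact_mod_cast hN
    have h1 : (m N : ℝ) / ((N : ℝ) / 2) - 1 = ((m N : ℝ) - N / 2) / ((N : ℝ) / 2) := by
      field_simp
    rw [h1, norm_div, Real.norm_eq_abs, Real.norm_of_nonneg (by positivity),
      div_le_iff₀ (by positivity)]
    refine (hm N).trans (le_of_eq ?_)
    field_simp
  simpa using h.add_const 1

theorem tendsto_half_atTop : Tendsto (fun N : ℕ => (N : ℝ) / 2) atTop atTop :=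
  tendsto_natCast_atTop_atTop.atTop_div_const two_pos

theorem sq_div_rpow_half {θ M : ℝ} (hM : 0 < M) (x : ℝ) :
    (x / M ^ (1 / (2 * θ))) ^ 2 = x ^ 2 / M ^ (1 / θ) := by
  rw [div_pow, ← Real.rpow_natCast (M ^ _), ← Real.rpow_mul hM.le]
  congr 2
  push_cast
  ring

theorem spow_div_rpow_half {θ M : ℝ} (hθ : 0 < θ) (hM : 0 < M) (y : ℝ) :
    spow θ (y / M ^ (1 / (2 * θ))) = spow θ y / M ^ (1 / 2 : ℝ) := by
  rw [← spow_div_rpow hθ (by positivity : 0 < M ^ (1 / 2 : ℝ)), ← Real.rpow_mul hM.le]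
  congr 3
  ring

theorem tendsto_hermiteKernel {α θ : ℝ} (hα : -1 < α) (hθ : 0 < θ) (x y : ℝ) :
    Tendsto (fun N : ℕ => (((N : ℝ) / 2) ^ ((α + 1) / (2 * θ)))⁻¹ *
        hermiteKernel α θ N (x / ((N : ℝ) / 2) ^ (1 / (2 * θ)))
          (y / ((N : ℝ) / 2) ^ (1 / (2 * θ))))
      atTop (𝓝 (limitKernelHer α θ x y)) := by
  have hβ : -1 < (α - 1) / 2 := by linarith
  have hβ' : -1 < (α + θ) / 2 := by linarith
  have hm1 := tendsto_div_half_of_abs_sub_le (m := fun N => (N + 1) / 2) (fun N => by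
    rw [abs_le]
    have h1 : 2 * ((N + 1) / 2) ≤ N + 1 := by omega
    have h2 : N ≤ 2 * ((N + 1) / 2) := by omega
    have h1' : (2 : ℝ) * ((N + 1) / 2 : ℕ) ≤ N + 1 := by exact_mod_cast h1
    have h2' : (N : ℝ) ≤ 2 * ((N + 1) / 2 : ℕ) := by exact_mod_cast h2
    constructor <;> linarith)
  have hm2 := tendsto_div_half_of_abs_sub_le (m := fun N => N / 2) (fun N => by
    rw [abs_le]
    have h1 : 2 * (N / 2) ≤ N := by omega
    have h2 : N ≤ 2 * (N / 2) + 1 := by omega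
    have h1' : (2 : ℝ) * (N / 2 : ℕ) ≤ N := by exact_mod_cast h1
    have h2' : (N : ℝ) ≤ 2 * (N / 2 : ℕ) + 1 := by exact_mod_cast h2
    constructor <;> linarith)
  have t1 := tendsto_laguerreKernel hβ hθ tendsto_half_atTop hm1 (sq_nonneg x) (y ^ 2)
  have t2 := tendsto_laguerreKernel hβ' hθ tendsto_half_atTop hm2 (sq_nonneg x) (y ^ 2)
  refine (t1.add (t2.const_mul (x * spow θ y))).congr' ?_
  filter_upwards [eventually_gt_atTop 0] with N hN
  have hM : (0 : ℝ) < (N : ℝ) / 2 := by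
    have : (0 : ℝ) < N := by exact_mod_cast hN
    positivity
  rw [hermiteKernel_eq_laguerreKernel hθ, sq_div_rpow_half hM, sq_div_rpow_half hM,
    spow_div_rpow_half hθ hM]
  have e1 : ((α - 1) / 2 + 1) / θ = (α + 1) / (2 * θ) := by
    field_simp
    ring
  -- The odd block has a larger natural exponent; the excess 1/(2θ) + 1/2 is exactly what the
  -- prefactor `x * spow θ y` loses under scaling.
  have e2 : ((α + θ) / 2 + 1) / θ = (α + 1) / (2 * θ) + 1 / (2 * θ) + 1 / 2 := by
    field_simp
    ring
  rw [e1, e2, Real.rpow_add hM, Real.rpow_add hM]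
  simp only [div_eq_mul_inv, mul_inv]
  ring

/-- If α < 0 and some coordinate is 0, the convention 0 ^ α = 0 of `Real.rpow` makes both the
correlation function and the limit vanish. -/
theorem tendsto_hermiteCorrelation {α θ : ℝ} (hα : -1 < α) (hθ : 0 < θ) {n : ℕ}
    (x : Fin n → ℝ) :
    Tendsto
      (fun N : ℕ => 1 / ((N : ℝ) / 2) ^ ((n : ℝ) / (2 * θ)) *
        hermiteCorrelation α θ n N (fun i => x i / ((N : ℝ) / 2) ^ (1 / (2 * θ))))
      atTop
      (𝓝 ((∏ i, |x i| ^ α) *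
        (Matrix.of fun i j => limitKernelHer α θ (x i) (x j)).det)) := by
  have hdet : Tendsto (fun N : ℕ => (Matrix.of fun i j : Fin n =>
      (((N : ℝ) / 2) ^ ((α + 1) / (2 * θ)))⁻¹ *
        hermiteKernel α θ N (x i / ((N : ℝ) / 2) ^ (1 / (2 * θ)))
          (x j / ((N : ℝ) / 2) ^ (1 / (2 * θ)))).det) atTop
      (𝓝 (Matrix.of fun i j => limitKernelHer α θ (x i) (x j)).det) := by
    refine ((continuous_id.matrix_det).tendsto _).comp ?_
    exact tendsto_pi_nhds.mpr fun i => tendsto_pi_nhds.mpr fun j =>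
      tendsto_hermiteKernel hα hθ (x i) (x j)
  have hweight : Tendsto (fun N : ℕ => ∏ i, |x i| ^ α *
      Real.exp (-(x i / ((N : ℝ) / 2) ^ (1 / (2 * θ))) ^ 2)) atTop
      (𝓝 (∏ i, |x i| ^ α)) := by
    refine tendsto_finsetProd _ fun i _ => ?_
    have h0 : Tendsto (fun N : ℕ => x i / ((N : ℝ) / 2) ^ (1 / (2 * θ))) atTop (𝓝 0) :=
      ((tendsto_rpow_atTop (by positivity)).comp tendsto_half_atTop).const_div_atTop (x i)
    have h1 := ((Real.continuous_exp.tendsto _).comp (h0.pow 2).neg).const_mul (|x i| ^ α)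
    simpa using h1
  refine (hweight.mul hdet).congr' ?_
  filter_upwards [eventually_gt_atTop 0, eventually_ge_atTop n] with N hN hn
  have hM : (0 : ℝ) < (N : ℝ) / 2 := by
    have : (0 : ℝ) < N := by exact_mod_cast hN
    positivity
  set M : ℝ := (N : ℝ) / 2 with hMdef
  have hentry : ∀ i j : Fin n, hermiteWeightedKernel α θ N (x i / M ^ (1 / (2 * θ)))
      (x j / M ^ (1 / (2 * θ))) = (M ^ (1 / (2 * θ)) *
        (|x i| ^ α * Real.exp (-(x i / M ^ (1 / (2 * θ))) ^ 2))) *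
        ((M ^ ((α + 1) / (2 * θ)))⁻¹ * hermiteKernel α θ N (x i / M ^ (1 / (2 * θ)))
          (x j / M ^ (1 / (2 * θ)))) := by
    intro i j
    -- The weight absorbs the power with exponent α, so one factor M ^ (1 / (2θ)) remains per row,
    -- and the n rows give the normalization of the theorem.
    have e : M ^ ((α + 1) / (2 * θ)) = (M ^ (1 / (2 * θ))) ^ α * M ^ (1 / (2 * θ)) := by
      rw [← Real.rpow_mul hM.le, ← Real.rpow_add hM]
      congr 1
      ring
    have hp : 0 < M ^ (1 / (2 * θ)) := by positivity
    have hp' : 0 < (M ^ (1 / (2 * θ))) ^ α := by positivity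
    rw [hermiteWeightedKernel, hermiteBaseWeight, abs_div, abs_of_pos hp,
      Real.div_rpow (abs_nonneg _) hp.le, e]
    field_simp
  have epow : M ^ ((n : ℝ) / (2 * θ)) = (M ^ (1 / (2 * θ))) ^ n := by
    rw [← Real.rpow_natCast, ← Real.rpow_mul hM.le]
    congr 1
    ring
  have hp : 0 < (M ^ (1 / (2 * θ))) ^ n := by positivity
  rw [hermiteCorrelation_eq_det hα hθ hn]
  simp only [hentry]
  have hcol := Matrix.det_mul_column (fun i => M ^ (1 / (2 * θ)) *
        (|x i| ^ α * Real.exp (-(x i / M ^ (1 / (2 * θ))) ^ 2)))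
    (Matrix.of fun i j : Fin n => (M ^ ((α + 1) / (2 * θ)))⁻¹ *
      hermiteKernel α θ N (x i / M ^ (1 / (2 * θ))) (x j / M ^ (1 / (2 * θ))))
  simp only [Matrix.of_apply] at hcol
  rw [hcol, epow, Finset.prod_mul_distrib (f := fun _ => M ^ (1 / (2 * θ))), Finset.prod_const,
    Finset.card_univ, Fintype.card_fin]
  field_simp

theorem theorem5p4 (α θ : ℝ) (hα : -1 < α) (hθ : 0 < θ) :
    -- the ensembles, their correlation functions and the kernels are well defined
    (∀ N : ℕ, Integrable (fun x : Fin N → ℝ => hermiteWeight α θ x) ∧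
      0 < hermitePartition α θ N) ∧
    (∀ n N : ℕ, n ≤ N → ∀ x : Fin n → ℝ,
      Integrable (fun y : Fin (N - n) → ℝ => hermiteDensity α θ (Fin.append x y))) ∧
    (∀ β : ℝ, -1 < β → ∀ x y : ℝ,
      Summable (fun p : ℕ × ℕ => limitKernelTerm β θ x y p.1 p.2)) ∧
    -- the scaling limit
    (∀ n : ℕ, 1 ≤ n → ∀ x : Fin n → ℝ,
      Tendsto
        (fun N : ℕ => 1 / ((N : ℝ) / 2) ^ ((n : ℝ) / (2 * θ)) *
          hermiteCorrelation α θ n N (fun i => x i / ((N : ℝ) / 2) ^ (1 / (2 * θ))))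
        atTop
        (𝓝 ((∏ i, |x i| ^ α) *
          (Matrix.of fun i j => limitKernelHer α θ (x i) (x j)).det))) :=
  ⟨fun N => ⟨integrable_hermiteWeight hα hθ N, hermitePartition_pos hα hθ N⟩,
    fun _ _ _ x => integrable_hermiteDensity_append hα hθ x,
    fun _ hβ x y => summable_limitKernelTerm hβ hθ x y,
    fun _ _ x => tendsto_hermiteCorrelation hα hθ x⟩
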